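/- **Conventions.** Let $R$ be a commutative Noetherian ring and $A$ an $R$-algebra that is finitely generated and projective as an $R$-module. Write $D=\operatorname{Hom}_R(-,R)$, which turns left $A$-modules into left $A^{op}$-modules. Let $\Lambda$ be a finite poset. For a family $\Theta=\{\Theta(\lambda)\}_{\lambda\in\Lambda}$ of $A$-modules and $\Gamma\subseteq\Lambda$, let $\mathcal F(\tilde\Theta_{\Gamma})$ be the class of $A$-modules $M$ having a finite filtration $0=F_0\subseteq F_1\subseteq\dots\subseteq F_t=M$ by submodules whose factors are each isomorphic to $\Theta(\mu)\otimes_R U$ for some $\mu\in\Gamma$ and some finitely generated projective $R$-module $U$; write $\mathcal F(\tilde\Theta)$ for $\Gamma=\Lambda$. The pair $(A,\{\Delta(\lambda)\}_{\lambda\in\Lambda})$ is a *split quasi-hereditary $R$-algebra* if: (i) each $\Delta(\lambda)$ is a finitely generated $A$-module, projective over $R$; (ii) $\operatorname{Hom}_A(\Delta(\lambda),\Delta(\mu))\neq 0$ implies $\lambda\le\mu$; (iii) $\operatorname{End}_A(\Delta(\lambda))\simeq R$; (iv) for each $\lambda$ there is a finitely generated projective $A$-module $P(\lambda)$ and an exact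 sequence $0\to C(\lambda)\to P(\lambda)\to\Delta(\lambda)\to 0$ with $C(\lambda)\in\mathcal F(\tilde\Delta_{\mu>\lambda})$; (v) the finitely generated projective $A$-modules are exactly the direct summands of finite direct sums of copies of $\bigoplus_\lambda P(\lambda)$. *Costandard modules* of a split quasi-hereditary algebra $(A,\{\Delta(\lambda)\})$ are finitely generated $A$-modules $\nabla(\lambda)$, $\lambda\in\Lambda$, projective over $R$, such that $(A^{op},\{D\nabla(\lambda)\}_{\lambda\in\Lambda})$ is split quasi-hereditary and $\operatorname{Ext}^i_A(\Delta(\lambda),\nabla(\beta))\simeq R$ if $i=0$ and $\lambda=\beta$, and $=0$ otherwise. A *characteristic tilting module* of $A$ is a module $T\simeq\bigoplus_{\lambda}T(\lambda)$ such that, for each $\lambda$, $T(\lambda)\in\mathcal F(\tilde\Delta)\cap\mathcal F(\tilde\nabla)$ and there are exact sequences $$0\to\Delta(\lambda)\to T(\lambda)\to X(\lambda)\to0,\qquad 0\to Y(\lambda)\to T(\lambda)\to\nabla(\lambda)\to0\qquad(*)$$ with $X(\lambda)\in\mathcal F(\tilde\Delta_{\mu<\lambda})$ and $Y(\lambda)\in\mathcal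 F(\tilde\nabla_{\mu<\lambda})$. **Statement.** Let $(A,\{\Delta(\lambda)\}_{\lambda\in\Lambda})$ be a split quasi-hereditary $R$-algebra with costandard modules $\nabla(\lambda)$, and let $S$ be a commutative $R$-algebra that is a Noetherian ring. Then: 1. $(S\otimes_RA,\{S\otimes_R\Delta(\lambda)\})$ is a split quasi-hereditary $S$-algebra, the modules $S\otimes_R\nabla(\lambda)$ are costandard modules of it, and for every family $\{\nabla'(\lambda)\}$ of costandard modules of it, $\nabla'(\lambda)\simeq S\otimes_R\nabla(\lambda)$ as $S\otimes_RA$-modules for all $\lambda\in\Lambda$. 2. If $T\simeq\bigoplus_\lambda T(\lambda)$ is a characteristic tilting module of $A$, with $T(\lambda)$ as above, then each $S\otimes_RT(\lambda)$ lies in $\mathcal F(\widetilde{S\otimes_R\Delta})\cap\mathcal F(\widetilde{S\otimes_R\nabla})$ and has exact sequences of the form $(*)$ over $S\otimes_RA$ with respect to $S\otimes_R\Delta$ and $S\otimes_R\nabla$; and $S\otimes_RT$ is a characteristic tilting module of $S\otimes_RA$. 3. If $M\in\mathcal F(\tilde\Delta)$ and $N\in\mathcal F(\tilde\nabla)$,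 then the canonical map $$S\otimes_R\operatorname{Hom}_A(M,N)\to\operatorname{Hom}_{S\otimes_RA}(S\otimes_RM,S\otimes_RN),\qquad s\otimes f\mapsto s\cdot(\operatorname{id}_S\otimes f),$$ is an isomorphism. -/

import Mathlib

open scoped TensorProduct DirectSum

universe u v w

namespace SplitQH

section BaseChange

variable (R : Type*) (S : Type*) (A : Type*) (M : Type*) (N : Type*)
  [CommRing R] [CommRing S] [Algebra R S] [Ring A] [Algebra R A]
  [AddCommGroup M] [Module R M] [Module A M] [IsScalarTower R A M]
  [AddCommGroup N] [Module R N] [Module A N] [IsScalarTower R A N]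

/-- The action of `S ⊗[R] A` on `S ⊗[R] M`, as a homomorphism into the endomorphisms. -/
noncomputable def baseChangeAction : S ⊗[R] A →ₐ[S] Module.End S (S ⊗[R] M) :=
  Algebra.TensorProduct.lift (Algebra.ofId S (Module.End S (S ⊗[R] M)))
    ((Module.End.baseChangeHom R S M).comp (Algebra.lsmul R R M))
    (fun s _ => Algebra.commutes s _)

/-- The `S ⊗[R] A`-module `S ⊗[R] M`, with `(s ⊗ a) • (t ⊗ m) = s t ⊗ a m`. -/
noncomputable instance baseChangeModule : Module (S ⊗[R] A) (S ⊗[R] M) :=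
  Module.compHom (S ⊗[R] M) (baseChangeAction R S A M).toRingHom

variable {R S A M N}

theorem tmul_smul_tmul (s t : S) (a : A) (m : M) :
    (s ⊗ₜ[R] a : S ⊗[R] A) • (t ⊗ₜ[R] m : S ⊗[R] M) = (s * t) ⊗ₜ[R] (a • m) := by
  change s • (t ⊗ₜ[R] (a • m) : S ⊗[R] M) = _
  rw [TensorProduct.smul_tmul', smul_eq_mul]

instance : IsScalarTower S (S ⊗[R] A) (S ⊗[R] M) where
  smul_assoc s x y := by
    change baseChangeAction R S A M (s • x) y = s • baseChangeAction R S A M x y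
    rw [map_smul]
    rfl

instance : IsScalarTower R (S ⊗[R] A) (S ⊗[R] M) where
  smul_assoc r x y := by
    rw [← algebraMap_smul S r x, ← algebraMap_smul S r (x • y), smul_assoc]

/-- The map `S ⊗ f` induced by an `A`-linear map `f`. -/
noncomputable def baseChangeMap (f : M →ₗ[A] N) : S ⊗[R] M →ₗ[S ⊗[R] A] S ⊗[R] N where
  toFun := (f.restrictScalars R).baseChange S
  map_add' := map_add _
  map_smul' x y := by
    simp only [RingHom.id_apply]
    induction x with
    | zero => simp
    | add x₁ x₂ h₁ h₂ => simp [add_smul, h₁, h₂]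
    | tmul s a =>
      induction y with
      | zero => simp
      | add y₁ y₂ h₁ h₂ => simp only [smul_add, map_add, h₁, h₂]
      | tmul t m => simp [tmul_smul_tmul]

variable (R S A M N)

/-- The canonical map `S ⊗ Hom_A(M, N) → Hom_{S ⊗ A}(S ⊗ M, S ⊗ N)`, `s ⊗ f ↦ s • (S ⊗ f)`. -/
noncomputable def homBaseChange :
    S ⊗[R] (M →ₗ[A] N) →ₗ[S] (S ⊗[R] M →ₗ[S ⊗[R] A] S ⊗[R] N) :=
  TensorProduct.AlgebraTensorModule.lift
    { toFun := fun s =>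
        { toFun := fun f => s • baseChangeMap f
          map_add' := fun f g => by
            ext y
            simp [baseChangeMap, LinearMap.restrictScalars_add, LinearMap.baseChange_add]
          map_smul' := fun r f => by
            ext y
            simp only [baseChangeMap, LinearMap.smul_apply, LinearMap.coe_mk, AddHom.coe_mk,
              RingHom.id_apply, LinearMap.restrictScalars_smul, LinearMap.baseChange_smul]
            rw [smul_comm] }
      map_add' := fun s t => by
        ext f y
        simp [add_smul]
      map_smul' := fun s t => by
        ext f y
        simp [mul_smul] }

theorem homBaseChange_tmul_tmul (s t : S) (f : M →ₗ[A] N) (m : M) :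
    homBaseChange R S A M N (s ⊗ₜ[R] f) (t ⊗ₜ[R] m) = (s * t) ⊗ₜ[R] f m := by
  simp [homBaseChange, baseChangeMap, TensorProduct.smul_tmul']

end BaseChange

section Dual

/-- The standard dual `D M = Hom_R(M, R)` of a left `A`-module `M`. -/
def StdDual (R : Type*) (M : Type*) [CommRing R] [AddCommGroup M] [Module R M] : Type _ := M →ₗ[R] R

/-- An element of the dual, as a linear form. -/
def StdDual.toLin {R : Type*} {M : Type*} [CommRing R] [AddCommGroup M] [Module R M]
    (f : StdDual R M) : M →ₗ[R] R := f

variable (R : Type*) (A : Type*) (M : Type*) [CommRing R] [Ring A] [Algebra R A]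
  [AddCommGroup M] [Module R M] [Module A M] [IsScalarTower R A M]

noncomputable instance : AddCommGroup (StdDual R M) := inferInstanceAs (AddCommGroup (M →ₗ[R] R))

noncomputable instance : Module R (StdDual R M) := inferInstanceAs (Module R (M →ₗ[R] R))

/-- `D M` is a left module over the opposite algebra: `(op a • f) m = f (a • m)`. -/
noncomputable instance dualModule : Module Aᵐᵒᵖ (StdDual R M) where
  smul a f := LinearMap.comp f.toLin (Algebra.lsmul R R M a.unop)
  one_smul f := LinearMap.ext fun m => congrArg f.toLin (one_smul A m)
  mul_smul a b f := LinearMap.ext fun m =>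
    congrArg f.toLin (mul_smul b.unop a.unop m)
  smul_zero _ := rfl
  smul_add _ _ _ := rfl
  add_smul a b f := LinearMap.ext fun m =>
    (congrArg f.toLin (add_smul a.unop b.unop m)).trans (map_add f.toLin _ _)
  zero_smul f := LinearMap.ext fun m =>
    (congrArg f.toLin (zero_smul A m)).trans (map_zero f.toLin)

theorem dual_smul_apply (a : Aᵐᵒᵖ) (f : StdDual R M) (m : M) :
    (a • f).toLin m = f.toLin (a.unop • m) := rfl

instance : IsScalarTower R Aᵐᵒᵖ (StdDual R M) where
  smul_assoc r a f := LinearMap.ext fun m =>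
    (congrArg f.toLin (smul_assoc r a.unop m)).trans (map_smul f.toLin r _)

end Dual

section Definitions

variable (R : Type u) (A : Type u) [CommRing R] [Ring A] [Algebra R A] {Λ : Type w}

/-- `M` has a finite filtration `0 = F 0 ⊆ F 1 ⊆ ⋯ ⊆ F t = M` by `A`-submodules, every factor of
which is isomorphic to `Θ μ ⊗[R] U` for some `μ ∈ Γ` and some finitely generated projective
`R`-module `U`. -/
def IsFilteredBy (Θ : Λ → Type u) [∀ l, AddCommGroup (Θ l)] [∀ l, Module R (Θ l)]
    [∀ l, Module A (Θ l)] [∀ l, IsScalarTower R A (Θ l)] (Γ : Set Λ)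
    (M : Type v) [AddCommGroup M] [Module A M] : Prop :=
  ∃ (t : ℕ) (F : ℕ → Submodule A M), Monotone F ∧ F 0 = ⊥ ∧ F t = ⊤ ∧
    ∀ i < t, ∃ μ ∈ Γ, ∃ U : ModuleCat.{u} R, Module.Finite R U ∧ Module.Projective R U ∧
      Nonempty ((F (i + 1) ⧸ (F i).submoduleOf (F (i + 1))) ≃ₗ[A] Θ μ ⊗[R] U)

/-- `N` lies in the additive closure of `M`: it is a direct summand of some `Mⁿ`. -/
def InAdd (M : Type v) [AddCommGroup M] [Module A M] (N : Type*) [AddCommGroup N] [Module A N] :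
    Prop :=
  ∃ (n : ℕ) (i : N →ₗ[A] (Fin n → M)) (p : (Fin n → M) →ₗ[A] N), p ∘ₗ i = LinearMap.id

/-- `(A, {Δ(λ)})` is a split quasi-hereditary `R`-algebra. -/
structure IsSplitQuasiHereditary [PartialOrder Λ] (Δ : Λ → Type u) [∀ l, AddCommGroup (Δ l)]
    [∀ l, Module R (Δ l)] [∀ l, Module A (Δ l)] [∀ l, IsScalarTower R A (Δ l)] : Prop where
  finite_algebra : Module.Finite R A
  projective_algebra : Module.Projective R A
  finite : ∀ l, Module.Finite A (Δ l)
  projective : ∀ l, Module.Projective R (Δ l)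
  le_of_hom_ne_zero : ∀ l m, (∃ f : Δ l →ₗ[A] Δ m, f ≠ 0) → l ≤ m
  end_equiv : ∀ l, Nonempty (Module.End A (Δ l) ≃ₐ[R] R)
  projective_covers : ∃ P : Λ → ModuleCat.{u} A,
    (∀ l, Module.Finite A (P l) ∧ Module.Projective A (P l) ∧
      ∃ π : P l →ₗ[A] Δ l, Function.Surjective π ∧
        IsFilteredBy R A Δ {m | l < m} (LinearMap.ker π)) ∧
    ∀ Q : ModuleCat.{u} A, InAdd A (⨁ l, P l) Q ↔ Module.Finite A Q ∧ Module.Projective A Q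

variable [PartialOrder Λ]
  (Δ : Λ → Type u) [∀ l, AddCommGroup (Δ l)]
  [∀ l, Module R (Δ l)] [∀ l, Module A (Δ l)] [∀ l, IsScalarTower R A (Δ l)]
  (C : Λ → Type u) [∀ l, AddCommGroup (C l)]
  [∀ l, Module R (C l)] [∀ l, Module A (C l)] [∀ l, IsScalarTower R A (C l)]

/-- `{C(λ)}` are costandard modules of `(A, {Δ(λ)})`: they are finitely generated and `R`-projective,
`(Aᵒᵖ, {D C(λ)})` is split quasi-hereditary, and `Extⁱ(Δ(λ), C(μ))` is `R` if `i = 0`, `λ = μ`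
and zero otherwise (the group `Ext⁰` being written as `Hom`). -/
structure IsCostandard : Prop where
  finite : ∀ l, Module.Finite A (C l)
  projective : ∀ l, Module.Projective R (C l)
  dual : IsSplitQuasiHereditary R Aᵐᵒᵖ (fun l => StdDual R (C l))
  hom_self : ∀ l, Nonempty ((Δ l →ₗ[A] C l) ≃ₗ[R] R)
  hom_of_ne : ∀ l m, l ≠ m → Subsingleton (Δ l →ₗ[A] C m)
  ext_pos : ∀ l m (i : ℕ), 0 < i →
    Subsingleton (CategoryTheory.Abelian.Ext (ModuleCat.of A (Δ l)) (ModuleCat.of A (C m)) i)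

/-- `M` is a partial tilting module, with respect to standard modules `Δ(λ)` and costandard
modules `C(λ)`. -/
def IsPartialTilting (M : Type v) [AddCommGroup M] [Module A M] : Prop :=
  IsFilteredBy R A Δ Set.univ M ∧ IsFilteredBy R A C Set.univ M

/-- Each `T(λ)` is partial tilting and there are exact sequences `0 → Δ(λ) → T(λ) → X(λ) → 0` and
`0 → Y(λ) → T(λ) → C(λ) → 0`, where `X(λ)` is filtered by modules `Δ(μ) ⊗ U`, and `Y(λ)` by
modules `C(μ) ⊗ U`, with `μ < λ`. -/
structure IsTiltingFamily (T : Λ → Type u) [∀ l, AddCommGroup (T l)] [∀ l, Module A (T l)] :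
    Prop where
  partial_tilting : ∀ l, IsPartialTilting R A Δ C (T l)
  standard_seq : ∀ l, ∃ i : Δ l →ₗ[A] T l, Function.Injective i ∧
    IsFilteredBy R A Δ {m | m < l} (T l ⧸ LinearMap.range i)
  costandard_seq : ∀ l, ∃ p : T l →ₗ[A] C l, Function.Surjective p ∧
    IsFilteredBy R A C {m | m < l} (LinearMap.ker p)

/-- `T` is a characteristic tilting module: `T = ⨁ T(λ)` for a family `T(λ)` as above. -/
def IsCharacteristicTilting (T : Type v) [AddCommGroup T] [Module A T] : Prop :=
  ∃ T' : Λ → ModuleCat.{u} A, IsTiltingFamily R A Δ C (fun l => T' l) ∧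
    Nonempty (T ≃ₗ[A] ⨁ l, T' l)

end Definitions

end SplitQH

/-! The central notion is `IsAdapted`: `Hom_A(M, N)` is projective over `R`, and `Hom_A(M, N) ⊗ W →
Hom_A(M, N ⊗ W)` is bijective for every `R`-module `W`. It holds if `M` is finitely generated
projective over `A` and `N` is projective over `R`. Given `0 → M' → M → M'' → 0` such that every map
`M' → N` extends to `M` (for instance if `Ext¹(M'', N) = 0`), the sequence of Homs into `N` is short
exact, and it splits once `Hom_A(M', N)` is projective. So adaptedness passes from `M'`, `M` to
`M''` and from `M'`, `M''` to `M`. Descending induction along `0 → C(λ) → P(λ) → Δ(λ) → 0` yields it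
for all `Δ(λ)` if `Ext¹(Δ(μ), N) = 0` for all `μ`, hence for `M ∈ F(Δ)` and `N ∈ F(∇)`
(`isAdapted_of_filtered`). Part 3 is the case `W = S`, read through the adjunction `Hom_{S⊗A}(S ⊗ M,
S ⊗ N) = Hom_A(M, N ⊗ S)`.

Short exact sequences whose last term is `R`-projective stay exact under `S ⊗ -`; this carries over
filtrations, projective covers and the tilting sequences. The maps `S ⊗ Δ(λ) → S ⊗ Δ(μ)` are
controlled by `Hom_A(P(λ), Δ(μ)) ⊗ S`, which is zero unless `λ ≤ μ` and is free on the projection if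
`λ = μ`. Axiom (v) is replaced by the equivalent condition `Generates`, which visibly survives base
change. For costandard modules, `S ⊗ D∇ = D(S ⊗ ∇)` over `S ⊗ Aᵒᵖ = (S ⊗ A)ᵒᵖ`, and the vanishing of
Ext follows by dimension shifting.

Uniqueness of costandard modules is proved over an arbitrary base ring, without localisation. If `f`
and `f'` generate `Hom(Δ(λ), ∇(λ))` and `Hom(Δ(λ), ∇'(λ))`, then `f` kills the kernel of `f'` with
any coefficients, so the image of `Df` lies in that of `Df'`. Lifting along a projective cover of
`D∇(λ)` over `Aᵒᵖ` produces `g` with `g ∘ f' = f` (`exists_comp_generator`). By symmetry there is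
`g'` with `g' ∘ f = f'`, and both composites are scalars fixing a generator, hence identities. -/

namespace SplitQH

set_option linter.unusedSectionVars false

/-! ### Filtered modules: induction, extension, vanishing of maps -/

section Filtrations

theorem mem_submoduleOf_iff {A M : Type*} [Ring A] [AddCommGroup M] [Module A M]
    {K N : Submodule A M} {x : K} : x ∈ N.submoduleOf K ↔ (x : M) ∈ N := Iff.rfl

theorem nonempty_quotient_equiv {A M Q : Type*} [Ring A] [AddCommGroup M] [Module A M]
    [AddCommGroup Q] [Module A Q] (K N : Submodule A M) (g : K →ₗ[A] Q)
    (hg : Function.Surjective g) (hker : LinearMap.ker g = N.submoduleOf K) :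
    Nonempty ((K ⧸ N.submoduleOf K) ≃ₗ[A] Q) :=
  ⟨(Submodule.quotEquivOfEq _ _ hker.symm).trans (g.quotKerEquivOfSurjective hg)⟩

variable {R A : Type u} [CommRing R] [Ring A] [Algebra R A] {Λ : Type w} {Θ : Λ → Type u}
  [∀ l, AddCommGroup (Θ l)] [∀ l, Module R (Θ l)] [∀ l, Module A (Θ l)]
  [∀ l, IsScalarTower R A (Θ l)] {Γ : Set Λ}

/-- To prove a property of filtered modules it suffices to check it for zero modules and to pass
from a submodule to the whole module along a factor `Θ μ ⊗ U`. -/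
theorem IsFilteredBy.induction
    (Q : ∀ (M : Type u) [AddCommGroup M] [Module R M] [Module A M] [IsScalarTower R A M], Prop)
    (zero : ∀ (M : Type u) [AddCommGroup M] [Module R M] [Module A M] [IsScalarTower R A M]
      [Subsingleton M], Q M)
    (step : ∀ (M' M : Type u) [AddCommGroup M'] [Module R M'] [Module A M'] [IsScalarTower R A M']
      [AddCommGroup M] [Module R M] [Module A M] [IsScalarTower R A M]
      (U : Type u) [AddCommGroup U] [Module R U] [Module.Finite R U] [Module.Projective R U]
      (f : M' →ₗ[A] M) (m : Λ) (g : M →ₗ[A] Θ m ⊗[R] U), m ∈ Γ → Function.Injective f →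
      Function.Exact f g → Function.Surjective g → Q M' → Q M)
    {M : Type u} [AddCommGroup M] [Module R M] [Module A M] [IsScalarTower R A M]
    (h : IsFilteredBy R A Θ Γ M) : Q M := by
  obtain ⟨t, F, hF, h0, ht, hs⟩ := h
  -- Treating every module embedded with image `F i`, and not only `F i` itself, makes it
  -- unnecessary to assume that `Q` is invariant under isomorphism.
  suffices H : ∀ i ≤ t, ∀ (M' : Type u) [AddCommGroup M'] [Module R M'] [Module A M']
      [IsScalarTower R A M'] (j : M' →ₗ[A] M), Function.Injective j → LinearMap.range j = F i →
      Q M' from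
    H t le_rfl M LinearMap.id Function.injective_id (by rw [ht, LinearMap.range_id])
  intro i
  induction i with
  | zero =>
    intro _ M' _ _ _ _ j hj hr
    have : Subsingleton M' := by
      refine ⟨fun x y => hj ?_⟩
      have hx : ∀ x, j x = 0 := fun x => by
        have := LinearMap.mem_range_self j x
        rwa [hr, h0, Submodule.mem_bot] at this
      rw [hx, hx]
    exact zero M'
  | succ i ih =>
    intro hi M' _ _ _ _ j hj hr
    obtain ⟨m, hm, U, hU, hU', ⟨e⟩⟩ := hs i hi
    let e' : M' ≃ₗ[A] F (i + 1) := (LinearEquiv.ofInjective j hj).trans (LinearEquiv.ofEq _ _ hr)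
    have he' : ∀ x, (e' x : M) = j x := fun x => rfl
    let f : F i →ₗ[A] M' := e'.symm.toLinearMap ∘ₗ Submodule.inclusion (hF (Nat.le_succ i))
    let g : M' →ₗ[A] Θ m ⊗[R] U := e.toLinearMap ∘ₗ Submodule.mkQ _ ∘ₗ e'.toLinearMap
    refine step (F i) M' U f m g hm ?_ ?_ ?_
      (ih (by omega) (F i) (F i).subtype (F i).injective_subtype (F i).range_subtype)
    · exact e'.symm.injective.comp (Submodule.inclusion_injective _)
    · intro x
      simp only [g, LinearMap.comp_apply, LinearEquiv.coe_coe, LinearEquiv.map_eq_zero_iff,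
        Submodule.mkQ_apply, Submodule.Quotient.mk_eq_zero, mem_submoduleOf_iff]
      constructor
      · intro hx
        refine ⟨⟨_, hx⟩, e'.injective ?_⟩
        exact e'.apply_symm_apply _
      · rintro ⟨y, rfl⟩
        simp [f]
    · exact e.surjective.comp ((Submodule.mkQ_surjective _).comp e'.surjective)

theorem IsFilteredBy.of_subsingleton (M : Type v) [AddCommGroup M] [Module A M] [Subsingleton M] :
    IsFilteredBy R A Θ Γ M :=
  ⟨0, fun _ => ⊥, monotone_const, rfl, Subsingleton.elim _ _, by simp⟩

theorem IsFilteredBy.of_exact {M' M : Type v} [AddCommGroup M'] [Module A M']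
    [AddCommGroup M] [Module A M] {U : Type u} [AddCommGroup U] [Module R U] [Module.Finite R U]
    [Module.Projective R U] {m : Λ} (hm : m ∈ Γ) (f : M' →ₗ[A] M) (g : M →ₗ[A] Θ m ⊗[R] U)
    (hf : Function.Injective f) (hfg : Function.Exact f g) (hg : Function.Surjective g)
    (h : IsFilteredBy R A Θ Γ M') : IsFilteredBy R A Θ Γ M := by
  obtain ⟨t, F, hF, h0, ht, hs⟩ := h
  refine ⟨t + 1, fun i => if i ≤ t then (F i).map f else ⊤, ?_, ?_, ?_, ?_⟩
  · intro i j hij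
    dsimp only
    split_ifs with h1 h2
    · exact Submodule.map_mono (hF hij)
    · exact le_top
    · omega
    · exact le_rfl
  · simp [h0]
  · simp
  · intro i hi
    rcases Nat.lt_or_ge i t with h | h
    · obtain ⟨μ, hμ, V, hV, hV', ⟨e⟩⟩ := hs i h
      refine ⟨μ, hμ, V, hV, hV', ?_⟩
      beta_reduce
      rw [if_pos (by omega : i + 1 ≤ t), if_pos (by omega : i ≤ t)]
      let e' := Submodule.equivMapOfInjective f hf (F (i + 1))
      refine nonempty_quotient_equiv _ _
        (e.toLinearMap ∘ₗ Submodule.mkQ _ ∘ₗ e'.symm.toLinearMap)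
        (e.surjective.comp ((Submodule.mkQ_surjective _).comp e'.symm.surjective)) ?_
      ext x
      obtain ⟨y, rfl⟩ := e'.surjective x
      simp only [LinearMap.mem_ker, LinearMap.comp_apply, LinearEquiv.coe_coe,
        LinearEquiv.map_eq_zero_iff, LinearEquiv.symm_apply_apply, Submodule.mkQ_apply,
        Submodule.Quotient.mk_eq_zero, mem_submoduleOf_iff]
      rw [Submodule.coe_equivMapOfInjective_apply]
      constructor
      · exact fun hy => ⟨_, hy, rfl⟩
      · rintro ⟨z, hz, hzy⟩
        rwa [← hf hzy]
    · obtain rfl : i = t := by omega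
      refine ⟨m, hm, ModuleCat.of R U, ‹_›, ‹_›, ?_⟩
      beta_reduce
      rw [if_neg (by omega : ¬ i + 1 ≤ i), if_pos le_rfl, ht]
      refine nonempty_quotient_equiv _ _ (g ∘ₗ (⊤ : Submodule A M).subtype) ?_ ?_
      · intro y
        obtain ⟨x, rfl⟩ := hg y
        exact ⟨⟨x, trivial⟩, rfl⟩
      · ext x
        simp only [LinearMap.mem_ker, LinearMap.comp_apply, Submodule.subtype_apply,
          mem_submoduleOf_iff, Submodule.map_top]
        exact hfg x

theorem IsFilteredBy.mono {Γ' : Set Λ} (hΓ : Γ ⊆ Γ') {M : Type v} [AddCommGroup M] [Module A M]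
    (h : IsFilteredBy R A Θ Γ M) : IsFilteredBy R A Θ Γ' M := by
  obtain ⟨t, F, hF, h0, ht, hs⟩ := h
  refine ⟨t, F, hF, h0, ht, fun i hi => ?_⟩
  obtain ⟨m, hm, U⟩ := hs i hi
  exact ⟨m, hΓ hm, U⟩

theorem IsFilteredBy.congr {M' M : Type v} [AddCommGroup M'] [Module A M'] [AddCommGroup M]
    [Module A M] (e : M' ≃ₗ[A] M) (h : IsFilteredBy R A Θ Γ M') : IsFilteredBy R A Θ Γ M := by
  -- If `Γ` has an element, an isomorphism is an extension with zero factor `Θ m ⊗ 0`. If `Γ` is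
  -- empty, only the zero module is filtered.
  by_cases hΓ : Γ.Nonempty
  · obtain ⟨m, hm⟩ := hΓ
    refine h.of_exact (U := PUnit) hm e.toLinearMap 0 e.injective (fun x => ?_) ?_
    · simp
    · exact fun y => ⟨0, Subsingleton.elim _ _⟩
  · obtain rfl : Γ = ∅ := Set.not_nonempty_iff_eq_empty.mp hΓ
    obtain ⟨t, F, hF, h0, ht, hs⟩ := h
    obtain rfl : t = 0 := by
      rcases Nat.eq_zero_or_pos t with h | h
      · exact h
      · obtain ⟨m, hm, -⟩ := hs 0 h
        exact hm.elim
    have : Subsingleton M' := by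
      rw [← Submodule.subsingleton_iff A]
      exact subsingleton_of_bot_eq_top (h0.symm.trans ht)
    have := e.symm.toEquiv.subsingleton
    exact .of_subsingleton M

/-- Maps from a filtered module vanish when maps from all standard factors do. -/
theorem IsFilteredBy.hom_eq_zero {N : Type v} [AddCommGroup N] [Module A N]
    (hN : ∀ m ∈ Γ, ∀ f : Θ m →ₗ[A] N, f = 0)
    {M : Type u} [AddCommGroup M] [Module R M] [Module A M] [IsScalarTower R A M]
    (h : IsFilteredBy R A Θ Γ M) (f : M →ₗ[A] N) : f = 0 := by
  revert f
  refine IsFilteredBy.induction (R := R) (fun M => ∀ f : M →ₗ[A] N, f = 0) ?_ ?_ h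
  · intro M _ _ _ _ _ f
    ext x
    rw [Subsingleton.elim x 0, map_zero, map_zero]
  · intro M' M _ _ _ _ _ _ _ _ U _ _ _ _ f m g hm hf hfg hg ih φ
    have h1 : LinearMap.ker g ≤ LinearMap.ker φ := fun x hx => by
      obtain ⟨y, rfl⟩ := (hfg x).mp hx
      exact LinearMap.congr_fun (ih (φ ∘ₗ f)) y
    -- Since `φ` vanishes on the kernel of `g`, its value at `x` depends only on `g x`. It is enough
    -- to treat pure tensors, and there `d ↦ d ⊗ y` is a map from `Θ m`.
    have key : ∀ z : Θ m ⊗[R] U, ∀ x, g x = z → φ x = 0 := by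
      intro z
      induction z with
      | zero => exact fun x hx => h1 hx
      | add z₁ z₂ h₁ h₂ =>
        intro x hx
        obtain ⟨x₁, rfl⟩ := hg z₁
        obtain ⟨x₂, rfl⟩ := hg z₂
        have : x - (x₁ + x₂) ∈ LinearMap.ker φ := h1 (by simp [hx])
        rw [LinearMap.mem_ker, map_sub, sub_eq_zero] at this
        rw [this, map_add, h₁ _ rfl, h₂ _ rfl, add_zero]
      | tmul d y =>
        intro x hx
        let ψ : Θ m ⊗[R] U →ₗ[A] N := 
          (LinearMap.ker g).liftQ φ h1 ∘ₗ (g.quotKerEquivOfSurjective hg).symm.toLinearMap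
        have hψ : ψ (g x) = φ x := by
          have : (g.quotKerEquivOfSurjective hg).symm (g x) = Submodule.Quotient.mk x := by
            rw [LinearEquiv.symm_apply_eq]; rfl
          simp [ψ, this]
        rw [← hψ, hx]
        exact LinearMap.congr_fun
          (hN m hm (ψ ∘ₗ (TensorProduct.AlgebraTensorModule.mk R A (Θ m) U).flip y)) d
    ext x
    exact key _ x rfl

end Filtrations

/-! ### Direct summands of finite powers -/

section SumRetract

/-- The identity of `M` is a finite sum of endomorphisms factoring through `M'`, that is, `M` is a
direct summand of a finite power of `M'`. -/
def IsSumRetract (A M M' : Type*) [Ring A] [AddCommGroup M] [Module A M] [AddCommGroup M']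
    [Module A M'] : Prop :=
  ∃ (n : ℕ) (i : Fin n → (M →ₗ[A] M')) (p : Fin n → (M' →ₗ[A] M)), ∀ x, ∑ k, p k (i k x) = x

theorem exists_dual_basis (A P : Type*) [Ring A] [AddCommGroup P] [Module A P] [Module.Finite A P]
    [Module.Projective A P] :
    ∃ (n : ℕ) (x : Fin n → P) (φ : Fin n → (P →ₗ[A] A)), ∀ y, ∑ k, φ k y • x k = y := by
  obtain ⟨n, f, g, -, -, h⟩ := Module.Finite.exists_comp_eq_id_of_projective A P
  refine ⟨n, fun k => f (Pi.single k 1), fun k => LinearMap.proj k ∘ₗ g, fun y => ?_⟩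
  conv_rhs => rw [← LinearMap.id_apply (R := A) y, ← h, LinearMap.comp_apply,
    LinearMap.pi_apply_eq_sum_univ f]
  refine Finset.sum_congr rfl fun k _ => ?_
  simp only [LinearMap.comp_apply, LinearMap.proj_apply]
  congr 2
  ext j
  simp [Pi.single_apply, eq_comm]

variable {A M M' : Type*} [Ring A] [AddCommGroup M] [Module A M] [AddCommGroup M'] [Module A M']

theorem isSumRetract_of_projective [Module.Finite A M] [Module.Projective A M] :
    IsSumRetract A M A := by
  obtain ⟨n, x, φ, h⟩ := exists_dual_basis A M
  exact ⟨n, φ, fun k => LinearMap.toSpanSingleton A M (x k), h⟩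

theorem IsSumRetract.finite_projective [Module.Finite A M'] [Module.Projective A M']
    (h : IsSumRetract A M M') : Module.Finite A M ∧ Module.Projective A M := by
  obtain ⟨n, i, p, h⟩ := h
  have h' : (LinearMap.lsum A (fun _ : Fin n => M') ℕ p) ∘ₗ LinearMap.pi i = LinearMap.id := by
    ext x
    simp [LinearMap.lsum_apply, h]
  have : Module.Projective A (Fin n → M') :=
    Module.Projective.of_equiv' (DFinsupp.linearEquivFunOnFintype (R := A) (M := fun _ : Fin n => M'))
  exact ⟨Module.Finite.of_surjective _ (LinearMap.surjective_of_comp_eq_id _ _ h'),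
    Module.Projective.of_split _ _ h'⟩

theorem isSumRetract_tensor {R : Type*} [CommRing R] [Algebra R A] [Module R M]
    [IsScalarTower R A M] (U : Type*) [AddCommGroup U] [Module R U] [Module.Finite R U]
    [Module.Projective R U] : IsSumRetract A (M ⊗[R] U) M := by
  obtain ⟨n, x, φ, h⟩ := exists_dual_basis R U
  refine ⟨n, fun k => (TensorProduct.AlgebraTensorModule.rid R A M).toLinearMap ∘ₗ
      TensorProduct.AlgebraTensorModule.map LinearMap.id (φ k),
    fun k => (TensorProduct.AlgebraTensorModule.mk R A M U).flip (x k), fun y => ?_⟩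
  induction y with
  | zero => simp
  | add y₁ y₂ h₁ h₂ =>
    simp only [map_add, Finset.sum_add_distrib, h₁, h₂]
  | tmul m v =>
    conv_rhs => rw [← h v, TensorProduct.tmul_sum]
    simp

end SumRetract

/-! ### Vanishing of Ext along exact sequences, summands and filtrations -/

section Ext

open CategoryTheory Abelian

variable {A : Type u} [Ring A] {M' M M'' N N' N'' : Type u}
  [AddCommGroup M'] [Module A M'] [AddCommGroup M] [Module A M] [AddCommGroup M''] [Module A M'']
  [AddCommGroup N'] [Module A N'] [AddCommGroup N] [Module A N] [AddCommGroup N''] [Module A N'']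

variable (A M N) in
/-- The group `Extⁱ(M, N)` is zero. -/
abbrev ExtZero (i : ℕ) : Prop := Subsingleton (Ext (ModuleCat.of A M) (ModuleCat.of A N) i)

theorem shortExact_of {f : M' →ₗ[A] M} {g : M →ₗ[A] M''} (hf : Function.Injective f)
    (hfg : Function.Exact f g) (hg : Function.Surjective g) :
    (ModuleCat.shortComplexOfCompEqZero f g hfg.linearMap_comp_eq_zero).ShortExact :=
  ModuleCat.shortComplex_shortExact _ hfg hf hg

theorem exists_extend_of_extZero {f : M' →ₗ[A] M} {g : M →ₗ[A] M''} (hf : Function.Injective f)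
    (hfg : Function.Exact f g) (hg : Function.Surjective g) (h : ExtZero A M'' N 1)
    (φ : M' →ₗ[A] N) : ∃ ψ : M →ₗ[A] N, ψ ∘ₗ f = φ := by
  obtain ⟨x, hx⟩ := Ext.contravariant_sequence_exact₁ (shortExact_of hf hfg hg)
    (ModuleCat.of A N) (Ext.mk₀ (ModuleCat.ofHom φ)) (n₁ := 1) rfl (Subsingleton.elim (h := h) _ _)
  obtain ⟨ψ, rfl⟩ := (Ext.mk₀_bijective _ _).2 x
  rw [Ext.mk₀_comp_mk₀] at hx
  have := (Ext.mk₀_bijective _ _).1 hx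
  exact ⟨ψ.hom, congrArg ModuleCat.Hom.hom this⟩

theorem extZero_middle_left {f : M' →ₗ[A] M} {g : M →ₗ[A] M''} (hf : Function.Injective f)
    (hfg : Function.Exact f g) (hg : Function.Surjective g) {i : ℕ} (h' : ExtZero A M' N i)
    (h'' : ExtZero A M'' N i) : ExtZero A M N i := by
  refine subsingleton_of_forall_eq 0 fun x => ?_
  obtain ⟨y, rfl⟩ := Ext.contravariant_sequence_exact₂ (shortExact_of hf hfg hg)
    (ModuleCat.of A N) x (Subsingleton.elim (h := h') _ _)
  rw [Subsingleton.elim (h := h'') y 0, Ext.comp_zero]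

theorem extZero_middle_right {f : N' →ₗ[A] N} {g : N →ₗ[A] N''} (hf : Function.Injective f)
    (hfg : Function.Exact f g) (hg : Function.Surjective g) {i : ℕ} (h' : ExtZero A M N' i)
    (h'' : ExtZero A M N'' i) : ExtZero A M N i := by
  refine subsingleton_of_forall_eq 0 fun x => ?_
  obtain ⟨y, rfl⟩ := Ext.covariant_sequence_exact₂ (ModuleCat.of A M) (shortExact_of hf hfg hg)
    x (Subsingleton.elim (h := h'') _ _)
  rw [Subsingleton.elim (h := h') y 0, Ext.zero_comp]

theorem extZero_of_sumRetract_left {i : ℕ} (hr : IsSumRetract A M M') (h : ExtZero A M' N i) :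
    ExtZero A M N i := by
  refine subsingleton_of_forall_eq 0 fun x => ?_
  obtain ⟨n, j, p, hjp⟩ := hr
  have hid : 𝟙 (ModuleCat.of A M) = ∑ k, ModuleCat.ofHom (j k) ≫ ModuleCat.ofHom (p k) := by
    ext m
    simp [hjp]
  rw [← Ext.mk₀_id_comp x, hid, Ext.mk₀_sum, Ext.sum_comp]
  refine Finset.sum_eq_zero fun k _ => ?_
  rw [← Ext.mk₀_comp_mk₀_assoc, Subsingleton.elim (h := h) ((Ext.mk₀ _).comp x _) 0, Ext.comp_zero]

theorem extZero_of_sumRetract_right {i : ℕ} (hr : IsSumRetract A N N') (h : ExtZero A M N' i) :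
    ExtZero A M N i := by
  refine subsingleton_of_forall_eq 0 fun x => ?_
  obtain ⟨n, j, p, hjp⟩ := hr
  have hid : 𝟙 (ModuleCat.of A N) = ∑ k, ModuleCat.ofHom (j k) ≫ ModuleCat.ofHom (p k) := by
    ext m
    simp [hjp]
  rw [← Ext.comp_mk₀_id x, hid, Ext.mk₀_sum, Ext.comp_sum]
  refine Finset.sum_eq_zero fun k _ => ?_
  rw [← Ext.mk₀_comp_mk₀, ← Ext.comp_assoc_of_third_deg_zero,
    Subsingleton.elim (h := h) (x.comp (Ext.mk₀ _) _) 0, Ext.zero_comp]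

theorem extZero_of_subsingleton_left [Subsingleton M] (i : ℕ) : ExtZero A M N i := by
  refine subsingleton_of_forall_eq 0 fun x => ?_
  have hid : 𝟙 (ModuleCat.of A M) = 0 := by
    ext m
    exact Subsingleton.elim (α := M) _ _
  rw [← Ext.mk₀_id_comp x, hid, Ext.mk₀_zero, Ext.zero_comp]

theorem extZero_of_subsingleton_right [Subsingleton N] (i : ℕ) : ExtZero A M N i := by
  refine subsingleton_of_forall_eq 0 fun x => ?_
  have hid : 𝟙 (ModuleCat.of A N) = 0 := by
    ext m
    exact Subsingleton.elim (α := N) _ _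
  rw [← Ext.comp_mk₀_id x, hid, Ext.mk₀_zero, Ext.comp_zero]

/-- As `M` is projective, every class in `Ext¹(M'', N)` is the extension class of the sequence
composed with some `φ : M' → N`. If `φ` extends to `M`, the product contains the extension class
followed by `f`, which is zero. -/
theorem extZero_one_of_extend [Module.Projective A M] {f : M' →ₗ[A] M} {g : M →ₗ[A] M''}
    (hf : Function.Injective f) (hfg : Function.Exact f g) (hg : Function.Surjective g)
    (h : ∀ φ : M' →ₗ[A] N, ∃ ψ : M →ₗ[A] N, ψ ∘ₗ f = φ) : ExtZero A M'' N 1 := by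
  refine subsingleton_of_forall_eq 0 fun x => ?_
  have : Projective (ModuleCat.of A M) := (ModuleCat.of A M).projective_of_categoryTheory_projective
  have hS := shortExact_of hf hfg hg
  obtain ⟨y, rfl⟩ := Ext.contravariant_sequence_exact₃ hS (ModuleCat.of A N) x
    (Ext.eq_zero_of_projective (P := ModuleCat.of A M) (n := 0) _) (n₀ := 0) rfl
  obtain ⟨φ, rfl⟩ := (Ext.mk₀_bijective _ _).2 y
  obtain ⟨ψ, hψ⟩ := h φ.hom
  have : φ = ModuleCat.ofHom f ≫ ModuleCat.ofHom ψ := by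
    ext m
    exact (LinearMap.congr_fun hψ m).symm
  rw [this, ← Ext.mk₀_comp_mk₀]
  have h0 := hS.extClass_comp
  rw [← Ext.comp_assoc_of_third_deg_zero]
  erw [h0]
  rw [Ext.zero_comp]

theorem extZero_succ_of_projective [Module.Projective A M] {f : M' →ₗ[A] M} {g : M →ₗ[A] M''}
    (hf : Function.Injective f) (hfg : Function.Exact f g) (hg : Function.Surjective g) {i : ℕ}
    (h : ExtZero A M' N i) : ExtZero A M'' N (i + 1) := by
  refine subsingleton_of_forall_eq 0 fun x => ?_
  have : Projective (ModuleCat.of A M) := (ModuleCat.of A M).projective_of_categoryTheory_projective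
  obtain ⟨y, rfl⟩ := Ext.contravariant_sequence_exact₃ (shortExact_of hf hfg hg)
    (ModuleCat.of A N) x (Ext.eq_zero_of_projective (P := ModuleCat.of A M) _) (add_comm 1 i)
  rw [Subsingleton.elim (h := h) y 0, Ext.comp_zero]

variable {R : Type u} [CommRing R] [Algebra R A] {Λ : Type w} {Θ : Λ → Type u}
  [∀ l, AddCommGroup (Θ l)] [∀ l, Module R (Θ l)] [∀ l, Module A (Θ l)]
  [∀ l, IsScalarTower R A (Θ l)] {Γ : Set Λ}

theorem IsFilteredBy.extZero_left [Module R M] [IsScalarTower R A M] {i : ℕ}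
    (hN : ∀ m ∈ Γ, ExtZero A (Θ m) N i) (h : IsFilteredBy R A Θ Γ M) : ExtZero A M N i := by
  refine IsFilteredBy.induction (R := R) (fun M => ExtZero A M N i) ?_ ?_ h
  · intro M _ _ _ _ _
    exact extZero_of_subsingleton_left i
  · intro M' M _ _ _ _ _ _ _ _ U _ _ _ _ f m g hm hf hfg hg ih
    exact extZero_middle_left hf hfg hg ih
      (extZero_of_sumRetract_left (isSumRetract_tensor U) (hN m hm))

theorem IsFilteredBy.extZero_right [Module R N] [IsScalarTower R A N] {i : ℕ}
    (hM : ∀ m ∈ Γ, ExtZero A M (Θ m) i) (h : IsFilteredBy R A Θ Γ N) : ExtZero A M N i := by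
  refine IsFilteredBy.induction (R := R) (fun N => ExtZero A M N i) ?_ ?_ h
  · intro M _ _ _ _ _
    exact extZero_of_subsingleton_right i
  · intro M' M _ _ _ _ _ _ _ _ U _ _ _ _ f m g hm hf hfg hg ih
    exact extZero_middle_right hf hfg hg ih
      (extZero_of_sumRetract_right (isSumRetract_tensor U) (hM m hm))

/-- Each step splits over `R`, because its factor `Θ m ⊗ U` is `R`-projective. -/
theorem IsFilteredBy.projective (hΘ : ∀ m ∈ Γ, Module.Projective R (Θ m)) [Module R M]
    [IsScalarTower R A M] (h : IsFilteredBy R A Θ Γ M) : Module.Projective R M := by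
  refine IsFilteredBy.induction (R := R) (fun M => Module.Projective R M) ?_ ?_ h
  · intro M _ _ _ _ _
    exact Module.Projective.of_free
  · intro M' M _ _ _ _ _ _ _ _ U _ _ _ _ f m g hm hf hfg hg ih
    have := hΘ m hm
    have hfg' : Function.Exact (f.restrictScalars R) (g.restrictScalars R) := hfg
    obtain ⟨s, hs⟩ := (g.restrictScalars R).exists_rightInverse_of_surjective
      (LinearMap.range_eq_top.mpr hg)
    obtain ⟨e, -⟩ := (hfg'.splitSurjectiveEquiv hf) ⟨s, hs⟩
    exact Module.Projective.of_equiv' e.symm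

end Ext

theorem exists_desc {A M' M M'' N : Type*} [Ring A] [AddCommGroup M'] [Module A M']
    [AddCommGroup M] [Module A M] [AddCommGroup M''] [Module A M''] [AddCommGroup N] [Module A N]
    {f : M' →ₗ[A] M} {g : M →ₗ[A] M''} (hfg : Function.Exact f g) (hg : Function.Surjective g)
    (φ : M →ₗ[A] N) (h : φ ∘ₗ f = 0) : ∃ ψ : M'' →ₗ[A] N, ψ ∘ₗ g = φ := by
  have hk : LinearMap.ker g ≤ LinearMap.ker φ := fun x hx => by
    obtain ⟨y, rfl⟩ := (hfg x).mp hx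
    exact LinearMap.congr_fun h y
  refine ⟨(LinearMap.ker g).liftQ φ hk ∘ₗ (g.quotKerEquivOfSurjective hg).symm.toLinearMap, ?_⟩
  ext x
  have : (g.quotKerEquivOfSurjective hg).symm (g x) = Submodule.Quotient.mk x := by
    rw [LinearEquiv.symm_apply_eq]; rfl
  simp [this]

theorem comp_left_cancel {A M M'' N : Type*} [Ring A] [AddCommGroup M] [Module A M]
    [AddCommGroup M''] [Module A M''] [AddCommGroup N] [Module A N] {g : M →ₗ[A] M''}
    (hg : Function.Surjective g) {φ ψ : M'' →ₗ[A] N} (h : φ ∘ₗ g = ψ ∘ₗ g) : φ = ψ := by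
  ext y
  obtain ⟨x, rfl⟩ := hg y
  exact LinearMap.congr_fun h x

/-! ### Homomorphisms with coefficients in an `R`-module -/

section Coefficients

variable (R A M M' M'' N W : Type*) [CommRing R] [Ring A] [Algebra R A]
  [AddCommGroup M] [Module A M] [AddCommGroup M'] [Module A M'] [AddCommGroup M''] [Module A M'']
  [AddCommGroup N] [Module R N] [Module A N] [IsScalarTower R A N] [AddCommGroup W] [Module R W]

/-- The canonical map `Hom_A(M, N) ⊗ W → Hom_A(M, N ⊗ W)`. -/
noncomputable def homTensor : (M →ₗ[A] N) ⊗[R] W →ₗ[R] (M →ₗ[A] N ⊗[R] W) :=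
  TensorProduct.lift (LinearMap.mk₂ R
    (fun f w => (TensorProduct.AlgebraTensorModule.mk R A N W).flip w ∘ₗ f)
    (fun f g w => by ext; simp [TensorProduct.add_tmul])
    (fun r f w => by ext; simp [TensorProduct.smul_tmul'])
    (fun f v w => by ext; simp)
    (fun r f w => by ext; simp))

variable {M M' M''} in
/-- Composition with `f`, as a map between the modules of homomorphisms to `N`. -/
def precomp (f : M' →ₗ[A] M) : (M →ₗ[A] N) →ₗ[R] (M' →ₗ[A] N) where
  toFun φ := φ ∘ₗ f
  map_add' _ _ := rfl
  map_smul' _ _ := rfl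

variable {R A M M' M'' N W}

@[simp]
theorem homTensor_tmul_apply (f : M →ₗ[A] N) (w : W) (m : M) :
    homTensor R A M N W (f ⊗ₜ w) m = f m ⊗ₜ w := rfl

@[simp]
theorem precomp_apply (f : M' →ₗ[A] M) (φ : M →ₗ[A] N) : precomp R A N f φ = φ ∘ₗ f := rfl

theorem homTensor_rTensor_precomp (f : M' →ₗ[A] M) (x : (M →ₗ[A] N) ⊗[R] W) :
    homTensor R A M' N W ((precomp R A N f).rTensor W x) = homTensor R A M N W x ∘ₗ f := by
  induction x with
  | zero => simp
  | add x y hx hy => simp [hx, hy, LinearMap.add_comp]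
  | tmul φ w => rfl

/-- Projectivity of `H'` splits the sequence, and a retraction of `i` remains one after tensoring.
-/
theorem rTensor_injective_of_exact {H'' H H' : Type*} [AddCommGroup H''] [Module R H'']
    [AddCommGroup H] [Module R H] [AddCommGroup H'] [Module R H'] [Module.Projective R H']
    {i : H'' →ₗ[R] H} {p : H →ₗ[R] H'} (hi : Function.Injective i) (hip : Function.Exact i p)
    (hp : Function.Surjective p) (W : Type*) [AddCommGroup W] [Module R W] :
    Function.Injective (i.rTensor W) ∧ Nonempty (H ≃ₗ[R] H'' × H') := by
  obtain ⟨s, hs⟩ := p.exists_rightInverse_of_surjective (LinearMap.range_eq_top.mpr hp)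
  obtain ⟨e, he, -⟩ := (hip.splitSurjectiveEquiv hi) ⟨s, hs⟩
  refine ⟨?_, ⟨e⟩⟩
  have hr : (LinearMap.fst R H'' H' ∘ₗ e.toLinearMap) ∘ₗ i = LinearMap.id := by
    rw [he]
    ext x
    simp
  refine Function.LeftInverse.injective
    (g := (LinearMap.fst R H'' H' ∘ₗ e.toLinearMap).rTensor W) fun x => ?_
  rw [← LinearMap.comp_apply, ← LinearMap.rTensor_comp, hr, LinearMap.rTensor_id,
    LinearMap.id_apply]

end Coefficients

/-! ### Pairs whose Hom commutes with coefficients -/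

section Adapted

variable (R A : Type*) (M M' M'' : Type*) (N : Type*) [CommRing R] [Ring A] [Algebra R A]
  [AddCommGroup M] [Module A M] [AddCommGroup M'] [Module A M'] [AddCommGroup M''] [Module A M'']
  [AddCommGroup N] [Module R N] [Module A N] [IsScalarTower R A N]

/-- `Hom_A(M, N)` is projective over `R`, and its formation commutes with extension of
coefficients in `N`. -/
structure IsAdapted : Prop where
  projective : Module.Projective R (M →ₗ[A] N)
  bijective : ∀ (W : Type u) [AddCommGroup W] [Module R W],
    Function.Bijective (homTensor R A M N W)

variable {R A M M' M'' N}

/-- By naturality of `homTensor` in the first argument, the map for `M` is a retract of a finite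
power of the map for `M'`. -/
theorem IsAdapted.of_sumRetract (hr : IsSumRetract A M M') (h : IsAdapted.{u} R A M' N) :
    IsAdapted.{u} R A M N := by
  obtain ⟨n, i, p, hip⟩ := hr
  have hH : ∀ φ : M →ₗ[A] N, ∑ k, (φ ∘ₗ p k) ∘ₗ i k = φ := fun φ => by
    ext x
    conv_rhs => rw [← hip x, map_sum]
    simp
  constructor
  · have := h.projective
    have : Module.Projective R (Fin n → (M' →ₗ[A] N)) :=
      Module.Projective.of_equiv'
        (DFinsupp.linearEquivFunOnFintype (R := R) (M := fun _ : Fin n => M' →ₗ[A] N))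
    refine Module.Projective.of_split (LinearMap.pi fun k => precomp R A N (p k))
      (LinearMap.lsum R (fun _ : Fin n => M' →ₗ[A] N) ℕ fun k => precomp R A N (i k)) ?_
    ext φ : 1
    simpa [LinearMap.lsum_apply] using hH φ
  · intro W _ _
    have hid : ∀ x : (M →ₗ[A] N) ⊗[R] W,
        ∑ k, (precomp R A N (i k)).rTensor W ((precomp R A N (p k)).rTensor W x) = x := by
      intro x
      induction x with
      | zero => simp
      | add x y hx hy => simp [Finset.sum_add_distrib, hx, hy]
      | tmul φ w =>
        conv_rhs => rw [← hH φ, TensorProduct.sum_tmul]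
        rfl
    constructor
    · rw [injective_iff_map_eq_zero]
      intro x hx
      rw [← hid x]
      refine Finset.sum_eq_zero fun k _ => ?_
      have : (precomp R A N (p k)).rTensor W x = 0 := by
        refine (injective_iff_map_eq_zero _).mp (h.bijective W).1 _ ?_
        rw [homTensor_rTensor_precomp, hx, LinearMap.zero_comp]
      rw [this, map_zero]
    · intro y
      choose z hz using fun k => (h.bijective W).2 (y ∘ₗ p k)
      refine ⟨∑ k, (precomp R A N (i k)).rTensor W (z k), ?_⟩
      simp only [map_sum, homTensor_rTensor_precomp, hz]
      ext x
      conv_rhs => rw [← hip x, map_sum]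
      simp

theorem IsAdapted.self [Module.Projective R N] : IsAdapted.{u} R A A N := by
  let e : (A →ₗ[A] N) ≃ₗ[R] N :=
    { toFun := fun φ => φ 1
      map_add' := fun _ _ => rfl
      map_smul' := fun _ _ => rfl
      invFun := fun n => LinearMap.toSpanSingleton A N n
      left_inv := fun φ => by ext; simp
      right_inv := fun n => by simp }
  refine ⟨Module.Projective.of_equiv' e.symm, fun W _ _ => ?_⟩
  have h : ∀ x, homTensor R A A N W x 1 = e.rTensor W x := fun x => by
    induction x with
    | zero => simp
    | add x y hx hy => simp [hx, hy]
    | tmul φ w => rfl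
  constructor
  · intro x y hxy
    apply (e.rTensor W).injective
    rw [← h, ← h, hxy]
  · intro φ
    refine ⟨(e.rTensor W).symm (φ 1), ?_⟩
    ext
    rw [h, LinearEquiv.apply_symm_apply]

theorem IsAdapted.of_projective [Module.Projective R N] [Module.Finite A M]
    [Module.Projective A M] : IsAdapted.{u} R A M N :=
  IsAdapted.self.of_sumRetract isSumRetract_of_projective

theorem IsAdapted.of_subsingleton [Subsingleton M] [Module.Projective R N] :
    IsAdapted.{u} R A M N :=
  IsAdapted.self.of_sumRetract ⟨0, 0, 0, fun _ => Subsingleton.elim _ _⟩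

section Exact

variable {f : M' →ₗ[A] M} {g : M →ₗ[A] M''} (hfg : Function.Exact f g)
  (hg : Function.Surjective g)

include hfg hg

theorem precomp_exact : Function.Exact (precomp R A N g) (precomp R A N f) := by
  intro φ
  constructor
  · exact fun h => exists_desc hfg hg φ h
  · rintro ⟨ψ, rfl⟩
    ext x
    simp [hfg.apply_apply_eq_zero]

omit hfg in
theorem precomp_injective : Function.Injective (precomp R A N g) :=
  fun _ _ h => comp_left_cancel hg h

/-- The Hom sequence into `N` is split exact, so `Hom(M'', N)` is a summand of `Hom(M, N)` and the
sequence stays exact after `⊗ W`. Bijectivity is then a diagram chase against the left exact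
sequence of maps into `N ⊗ W`. -/
theorem IsAdapted.of_exact (h' : IsAdapted.{u} R A M' N) (h : IsAdapted.{u} R A M N)
    (hs : ∀ φ : M' →ₗ[A] N, ∃ ψ : M →ₗ[A] N, ψ ∘ₗ f = φ) :
    IsAdapted.{u} R A M'' N := by
  have := h'.projective
  have := h.projective
  have hex := precomp_exact (R := R) (N := N) hfg hg
  have hinj := precomp_injective (R := R) (N := N) hg
  constructor
  · obtain ⟨e⟩ := (rTensor_injective_of_exact hinj hex hs R).2
    exact Module.Projective.of_split (e.symm.toLinearMap ∘ₗ LinearMap.inl R _ _)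
      (LinearMap.fst R _ _ ∘ₗ e.toLinearMap) (by ext; simp)
  · intro W _ _
    have hW := (rTensor_injective_of_exact hinj hex hs W).1
    constructor
    · rw [injective_iff_map_eq_zero]
      intro x hx
      refine (injective_iff_map_eq_zero _).mp hW _
        ((injective_iff_map_eq_zero _).mp (h.bijective W).1 _ ?_)
      rw [homTensor_rTensor_precomp, hx, LinearMap.zero_comp]
    · intro y
      obtain ⟨x, hx⟩ := (h.bijective W).2 (y ∘ₗ g)
      have h0 : (precomp R A N f).rTensor W x = 0 := by
        refine (injective_iff_map_eq_zero _).mp (h'.bijective W).1 _ ?_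
        rw [homTensor_rTensor_precomp, hx, LinearMap.comp_assoc, hfg.linearMap_comp_eq_zero,
          LinearMap.comp_zero]
      obtain ⟨z, rfl⟩ := (rTensor_exact W hex hs x).mp h0
      refine ⟨z, comp_left_cancel hg ?_⟩
      rw [← hx, homTensor_rTensor_precomp]

omit hfg hg in
-- Surjectivity of restriction survives `⊗ W`, and all maps `M' → N ⊗ W` come from `Hom(M', N) ⊗ W`.
-- In this form extension of maps can be carried over to `S`.
theorem IsAdapted.exists_extend (h' : IsAdapted.{u} R A M' N)
    (hs : ∀ φ : M' →ₗ[A] N, ∃ ψ : M →ₗ[A] N, ψ ∘ₗ f = φ)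
    {W : Type u} [AddCommGroup W] [Module R W] (φ : M' →ₗ[A] N ⊗[R] W) :
    ∃ ψ : M →ₗ[A] N ⊗[R] W, ψ ∘ₗ f = φ := by
  obtain ⟨x, rfl⟩ := (h'.bijective W).2 φ
  obtain ⟨y, rfl⟩ := LinearMap.rTensor_surjective W (g := precomp R A N f) hs x
  exact ⟨_, (homTensor_rTensor_precomp f y).symm⟩

/-- This is the five lemma for the split exact Hom sequence tensored with `W`; the splitting also
gives `Hom(M, N) ≃ Hom(M'', N) × Hom(M', N)`. -/
theorem IsAdapted.middle (h' : IsAdapted.{u} R A M' N) (h'' : IsAdapted.{u} R A M'' N)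
    (hs : ∀ φ : M' →ₗ[A] N, ∃ ψ : M →ₗ[A] N, ψ ∘ₗ f = φ) :
    IsAdapted.{u} R A M N := by
  have := h'.projective
  have := h''.projective
  have hex := precomp_exact (R := R) (N := N) hfg hg
  have hinj := precomp_injective (R := R) (N := N) hg
  constructor
  · obtain ⟨e⟩ := (rTensor_injective_of_exact hinj hex hs R).2
    exact Module.Projective.of_equiv' e.symm
  · intro W _ _
    constructor
    · rw [injective_iff_map_eq_zero]
      intro x hx
      have h0 : (precomp R A N f).rTensor W x = 0 := by
        refine (injective_iff_map_eq_zero _).mp (h'.bijective W).1 _ ?_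
        rw [homTensor_rTensor_precomp, hx, LinearMap.zero_comp]
      obtain ⟨z, rfl⟩ := (rTensor_exact W hex hs x).mp h0
      rw [homTensor_rTensor_precomp] at hx
      have : homTensor R A M'' N W z = 0 :=
        comp_left_cancel hg (hx.trans (LinearMap.zero_comp g).symm)
      rw [(injective_iff_map_eq_zero _).mp (h''.bijective W).1 z this, map_zero]
    · intro y
      obtain ⟨x', hx'⟩ := (h'.bijective W).2 (y ∘ₗ f)
      obtain ⟨x, rfl⟩ := LinearMap.rTensor_surjective W (g := precomp R A N f) hs x'
      obtain ⟨z, hz⟩ := exists_desc hfg hg (y - homTensor R A M N W x) (by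
        rw [LinearMap.sub_comp, ← hx', homTensor_rTensor_precomp, sub_self])
      obtain ⟨x'', rfl⟩ := (h''.bijective W).2 z
      refine ⟨x + (precomp R A N g).rTensor W x'', ?_⟩
      rw [map_add, homTensor_rTensor_precomp, hz, add_sub_cancel]

end Exact

end Adapted

/-! ### Adaptedness of filtered modules -/

section Filtered

variable {R A : Type u} [CommRing R] [Ring A] [Algebra R A] {Λ : Type w} {Θ : Λ → Type u}
  [∀ l, AddCommGroup (Θ l)] [∀ l, Module R (Θ l)] [∀ l, Module A (Θ l)]
  [∀ l, IsScalarTower R A (Θ l)] {Γ : Set Λ}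
  {M N : Type u} [AddCommGroup M] [Module R M] [Module A M] [IsScalarTower R A M]
  [AddCommGroup N] [Module R N] [Module A N] [IsScalarTower R A N]

theorem IsFilteredBy.isAdapted [Module.Projective R N]
    (hN : ∀ m ∈ Γ, IsAdapted.{u} R A (Θ m) N) (hE : ∀ m ∈ Γ, ExtZero A (Θ m) N 1)
    (h : IsFilteredBy R A Θ Γ M) : IsAdapted.{u} R A M N := by
  refine IsFilteredBy.induction (R := R) (fun M => IsAdapted.{u} R A M N) ?_ ?_ h
  · intro M _ _ _ _ _
    exact .of_subsingleton
  · intro M' M _ _ _ _ _ _ _ _ U _ _ _ _ f m g hm hf hfg hg ih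
    exact ih.middle hfg hg ((hN m hm).of_sumRetract (isSumRetract_tensor U))
      (exists_extend_of_extZero hf hfg hg
        (extZero_of_sumRetract_left (isSumRetract_tensor U) (hE m hm)))

end Filtered

/-! ### Generating families of projectives -/

section Generates

/-- The modules `P l` generate the category of `A`-modules: the unit of `A` is a sum of values of
homomorphisms `P l → A`. -/
def Generates (A : Type*) {Λ : Type*} (P : Λ → Type*) [Ring A] [∀ l, AddCommGroup (P l)]
    [∀ l, Module A (P l)] : Prop :=
  ∃ (n : ℕ) (ν : Fin n → Λ) (a : ∀ k, P (ν k) →ₗ[A] A) (x : ∀ k, P (ν k)), ∑ k, a k (x k) = 1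

variable {A : Type u} {Λ : Type w} {P : Λ → Type v} [Ring A] [∀ l, AddCommGroup (P l)]
    [∀ l, Module A (P l)]

/-- Since `A` is a summand of a power of `⨁ P l`, the unit `1 = p (i 1)` lies in the span of the
values of maps `P l → A`. Coefficients are absorbed into the arguments of these maps. -/
theorem generates_of_inAdd (h : InAdd A (⨁ l, P l) A) : Generates A P := by
  classical
  obtain ⟨n, i, p, hp⟩ := h
  let s : Set A := {y | ∃ (l : Λ) (a : P l →ₗ[A] A) (x : P l), a x = y}
  have hs : ∀ y : ⨁ l, P l, ∀ q : (⨁ l, P l) →ₗ[A] A, q y ∈ Submodule.span A s := by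
    intro y q
    induction y using DirectSum.induction_on with
    | zero => simp
    | of l x => exact Submodule.subset_span ⟨l, q ∘ₗ DirectSum.lof A Λ P l, x, rfl⟩
    | add x y hx hy => rw [map_add]; exact add_mem hx hy
  have h1 : (1 : A) ∈ Submodule.span A s := by
    have h2 : p (i 1) = 1 := LinearMap.congr_fun hp 1
    rw [← h2, ← Finset.univ_sum_single (i 1), map_sum]
    exact sum_mem fun k _ => hs _ (p ∘ₗ LinearMap.single A (fun _ => ⨁ l, P l) k)
  obtain ⟨n, c, g, hg⟩ := (Submodule.mem_span_set' (s := s)).mp h1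
  choose ν a x hx using fun k => (g k).2
  exact ⟨n, ν, a, fun k => c k • x k, by simpa [hx] using hg⟩

/-- A map vanishes if its composites with all maps from generators vanish. -/
theorem Generates.eq_zero (h : Generates A P) {X Y : Type*} [AddCommGroup X] [Module A X]
    [AddCommGroup Y] [Module A Y] (f : X →ₗ[A] Y) (hf : ∀ l, ∀ g : P l →ₗ[A] X, f ∘ₗ g = 0) :
    f = 0 := by
  obtain ⟨n, ν, a, x, hx⟩ := h
  ext y
  rw [← one_smul A y, ← hx, Finset.sum_smul, map_sum]
  exact Finset.sum_eq_zero fun k _ =>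
    LinearMap.congr_fun (hf _ (LinearMap.toSpanSingleton A X y ∘ₗ a k)) (x k)

theorem Generates.inAdd_iff [Finite Λ] (h : Generates A P) (hf : ∀ l, Module.Finite A (P l))
    (hp : ∀ l, Module.Projective A (P l)) (Q : Type u) [AddCommGroup Q] [Module A Q] :
    InAdd A (⨁ l, P l) Q ↔ Module.Finite A Q ∧ Module.Projective A Q := by
  classical
  have := Fintype.ofFinite Λ
  constructor
  · rintro ⟨n, i, p, hip⟩
    have : Module.Finite A (⨁ l, P l) :=
      inferInstanceAs (Module.Finite A (Π₀ l, P l))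
    refine IsSumRetract.finite_projective (M' := ⨁ l, P l)
      ⟨n, fun k => LinearMap.proj k ∘ₗ i, fun k => p ∘ₗ LinearMap.single A (fun _ => ⨁ l, P l) k,
        fun x => ?_⟩
    conv_rhs => rw [← LinearMap.id_apply (R := A) x, ← hip, LinearMap.comp_apply,
      ← Finset.univ_sum_single (i x), map_sum]
    rfl
  · rintro ⟨hQ, hQ'⟩
    -- Combining `q = ∑ φₖ(q) yₖ` with `1 = ∑ aⱼ(xⱼ)` gives `q = ∑ φₖ(q) aⱼ(xⱼ) yₖ`. So `Q` embeds
    -- by `q ↦ φₖ(q) xⱼ`, and `z ↦ aⱼ(z) yₖ` retracts it.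
    obtain ⟨m, y, φ, hφ⟩ := exists_dual_basis A Q
    obtain ⟨n, ν, a, x, hx⟩ := h
    let e := Fintype.equivFin (Fin m × Fin n)
    refine ⟨Fintype.card (Fin m × Fin n),
      LinearMap.pi fun k => DirectSum.lof A Λ P (ν (e.symm k).2) ∘ₗ
        LinearMap.toSpanSingleton A _ (x (e.symm k).2) ∘ₗ φ (e.symm k).1,
      LinearMap.lsum A (fun _ => ⨁ l, P l) ℕ fun k => LinearMap.toSpanSingleton A Q (y (e.symm k).1) ∘ₗ
        a (e.symm k).2 ∘ₗ DirectSum.component A Λ P (ν (e.symm k).2), ?_⟩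
    ext q
    simp only [LinearMap.comp_apply, LinearMap.lsum_apply, LinearMap.sum_apply,
      LinearMap.proj_apply, LinearMap.pi_apply, LinearMap.id_apply, LinearMap.toSpanSingleton_apply,
      DirectSum.component.lof_self, map_smul]
    rw [Equiv.sum_comp e.symm (fun k : Fin m × Fin n => φ k.1 q • a k.2 (x k.2) • y k.1),
      Fintype.sum_prod_type]
    conv_rhs => rw [← hφ q]
    refine Finset.sum_congr rfl fun k _ => ?_
    dsimp only
    rw [← Finset.smul_sum, ← Finset.sum_smul, hx, one_smul]

end Generates

/-! ### Projective covers of standard modules -/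

section Cover

variable {R A : Type u} [CommRing R] [Ring A] [Algebra R A] {Λ : Type w} [PartialOrder Λ]
  {Δ P : Λ → Type u}
  [∀ l, AddCommGroup (Δ l)] [∀ l, Module R (Δ l)] [∀ l, Module A (Δ l)]
  [∀ l, IsScalarTower R A (Δ l)]
  [∀ l, AddCommGroup (P l)] [∀ l, Module R (P l)] [∀ l, Module A (P l)]
  [∀ l, IsScalarTower R A (P l)]

variable (R) in
/-- The maps `π l : P l → Δ l` form a family of projective covers as in the definition of a split
quasi-hereditary algebra. -/
structure IsCover (π : ∀ l, P l →ₗ[A] Δ l) : Prop where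
  finite : ∀ l, Module.Finite A (P l)
  projective : ∀ l, Module.Projective A (P l)
  surjective : ∀ l, Function.Surjective (π l)
  filtered : ∀ l, IsFilteredBy R A Δ {m | l < m} (LinearMap.ker (π l))
  generates : Generates A P

theorem IsSplitQuasiHereditary.exists_cover (h : IsSplitQuasiHereditary R A Δ) :
    ∃ (P : Λ → Type u) (_ : ∀ l, AddCommGroup (P l)) (_ : ∀ l, Module R (P l))
      (_ : ∀ l, Module A (P l)) (_ : ∀ l, IsScalarTower R A (P l)) (π : ∀ l, P l →ₗ[A] Δ l),
      IsCover R π := by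
  obtain ⟨P, hP, hQ⟩ := h.projective_covers
  choose hf hp π hπ hF using hP
  let _ : ∀ l, Module R (P l) := fun l => Module.compHom _ (algebraMap R A)
  refine ⟨fun l => P l, fun l => inferInstance, fun l => inferInstance, fun l => inferInstance,
    fun l => .of_algebraMap_smul fun r x => rfl, π, hf, hp, hπ, hF,
    generates_of_inAdd ((hQ (ModuleCat.of A A)).mpr ⟨inferInstanceAs (Module.Finite A A),
      inferInstanceAs (Module.Projective A A)⟩)⟩

/-- An `R`-algebra isomorphism `End(Δ l) ≃ R` can only be inverse to the structure map. The axiom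
thus becomes a property of a canonical map. -/
theorem IsSplitQuasiHereditary.algebraMap_end_bijective (h : IsSplitQuasiHereditary R A Δ) (l : Λ) :
    Function.Bijective (algebraMap R (Module.End A (Δ l))) := by
  obtain ⟨e⟩ := h.end_equiv l
  have : ∀ r, algebraMap R (Module.End A (Δ l)) r = e.symm r := fun r => by
    rw [← AlgEquiv.commutes e.symm r]; rfl
  rw [funext this]
  exact e.symm.bijective

theorem IsSplitQuasiHereditary.of_cover [Finite Λ] {π : ∀ l, P l →ₗ[A] Δ l} (hπ : IsCover R π)
    (h₁ : Module.Finite R A) (h₂ : Module.Projective R A) (h₃ : ∀ l, Module.Finite A (Δ l))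
    (h₄ : ∀ l, Module.Projective R (Δ l))
    (h₅ : ∀ l m, ¬ l ≤ m → ∀ f : Δ l →ₗ[A] Δ m, f = 0)
    (h₆ : ∀ l, Function.Bijective (algebraMap R (Module.End A (Δ l)))) :
    IsSplitQuasiHereditary R A Δ where
  finite_algebra := h₁
  projective_algebra := h₂
  finite := h₃
  projective := h₄
  le_of_hom_ne_zero l m := fun ⟨f, hf⟩ => not_not.mp fun hlm => hf (h₅ l m hlm f)
  end_equiv l := ⟨(AlgEquiv.ofBijective (Algebra.ofId R _) (h₆ l)).symm⟩
  projective_covers := ⟨fun l => ModuleCat.of A (P l),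
    fun l => ⟨hπ.finite l, hπ.projective l, π l, hπ.surjective l, hπ.filtered l⟩,
    fun Q => hπ.generates.inAdd_iff hπ.finite hπ.projective Q⟩

namespace IsCover

variable {π : ∀ l, P l →ₗ[A] Δ l} (hπ : IsCover R π) {N : Type v} [AddCommGroup N] [Module A N]
include hπ

/-- The kernel of `π l` is filtered by the `Δ m` with `m > l`, so `f` vanishes on it. -/
theorem exists_comp_eq {l : Λ} (hN : ∀ m, l < m → ∀ f : Δ m →ₗ[A] N, f = 0) (f : P l →ₗ[A] N) :
    ∃ g : Δ l →ₗ[A] N, g ∘ₗ π l = f :=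
  exists_desc (LinearMap.exact_subtype_ker_map (π l)) (hπ.surjective l) f
    ((hπ.filtered l).hom_eq_zero hN _)

theorem hom_eq_zero {l : Λ} (hN : ∀ m, l ≤ m → ∀ f : Δ m →ₗ[A] N, f = 0) (f : P l →ₗ[A] N) :
    f = 0 := by
  obtain ⟨g, rfl⟩ := hπ.exists_comp_eq (fun m hm => hN m hm.le) f
  rw [hN l le_rfl g, LinearMap.zero_comp]

theorem standard_hom_eq_zero {l : Λ} (hN : ∀ f : P l →ₗ[A] N, f = 0) (f : Δ l →ₗ[A] N) : f = 0 :=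
  comp_left_cancel (hπ.surjective l) ((hN _).trans (LinearMap.zero_comp _).symm)

theorem isFilteredBy (l : Λ) : IsFilteredBy R A Δ Set.univ (P l) := by
  let e := (TensorProduct.AlgebraTensorModule.rid R A (Δ l)).symm
  refine ((hπ.filtered l).mono (Set.subset_univ _)).of_exact (Set.mem_univ l)
    (LinearMap.ker (π l)).subtype (e.toLinearMap ∘ₗ π l) (Submodule.injective_subtype _) ?_
    (e.surjective.comp (hπ.surjective l))
  intro x
  simp

omit N [AddCommGroup N] [Module A N] in
theorem exists_lift {l : Λ} {X Y : Type*} [AddCommGroup X] [Module A X] [AddCommGroup Y]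
    [Module A Y] {f : X →ₗ[A] Y} (hf : Function.Surjective f) (g : P l →ₗ[A] Y) :
    ∃ h : P l →ₗ[A] X, f ∘ₗ h = g :=
  have := hπ.projective l
  Module.projective_lifting_property f g hf

end IsCover

/-- Descending induction on `l`: the kernel of `π l` is filtered by `Δ m` with `m > l`, hence
adapted, and `P l` is adapted because it is projective. `Ext¹(Δ l, N) = 0` lets maps extend from the
kernel to `P l`. -/
theorem isAdapted_standard [Finite Λ] {π : ∀ l, P l →ₗ[A] Δ l} (hπ : IsCover R π)
    {N : Type u} [AddCommGroup N] [Module R N] [Module A N] [IsScalarTower R A N]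
    [Module.Projective R N] (hN : ∀ l, ExtZero A (Δ l) N 1) (l : Λ) :
    IsAdapted.{u} R A (Δ l) N := by
  induction l using WellFoundedGT.induction with
  | _ l ih =>
    have := hπ.finite l
    have := hπ.projective l
    have hex := LinearMap.exact_subtype_ker_map (π l)
    exact IsAdapted.of_exact hex (hπ.surjective l)
      ((hπ.filtered l).isAdapted ih fun m _ => hN m) .of_projective
      (exists_extend_of_extZero (Submodule.injective_subtype _) hex (hπ.surjective l) (hN l))

end Cover

/-- Elements of `H ⊗ W` for `H` free on one generator. -/
theorem tmul_bijective_of_generator {R H W : Type*} [CommRing R] [AddCommGroup H] [Module R H]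
    [AddCommGroup W] [Module R W] {v : H} (hv : Function.Bijective fun r : R => r • v) :
    Function.Bijective fun w : W => v ⊗ₜ[R] w := by
  let e : R ≃ₗ[R] H := LinearEquiv.ofBijective (LinearMap.toSpanSingleton R H v) hv
  have : (fun w : W => v ⊗ₜ[R] w) = (TensorProduct.lid R W).symm ≪≫ₗ e.rTensor W := by
    ext w
    have he : e 1 = v := one_smul R v
    simp [he]
  rw [this]
  exact LinearEquiv.bijective _

/-! ### Maps between standard modules with coefficients -/

section StandardHoms

variable {R A : Type u} [CommRing R] [Ring A] [Algebra R A] {Λ : Type w} [PartialOrder Λ]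
  {Δ P : Λ → Type u}
  [∀ l, AddCommGroup (Δ l)] [∀ l, Module R (Δ l)] [∀ l, Module A (Δ l)]
  [∀ l, IsScalarTower R A (Δ l)]
  [∀ l, AddCommGroup (P l)] [∀ l, Module R (P l)] [∀ l, Module A (P l)]
  [∀ l, IsScalarTower R A (P l)] {π : ∀ l, P l →ₗ[A] Δ l}
  {W : Type u} [AddCommGroup W] [Module R W]

theorem IsSplitQuasiHereditary.hom_eq_zero (h : IsSplitQuasiHereditary R A Δ) {l m : Λ}
    (hlm : ¬ l ≤ m) (f : Δ l →ₗ[A] Δ m) : f = 0 :=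
  not_not.mp fun hf => hlm (h.le_of_hom_ne_zero l m ⟨f, hf⟩)

theorem IsCover.isAdapted (hπ : IsCover R π) (l : Λ) (N : Type v) [AddCommGroup N] [Module R N]
    [Module A N] [IsScalarTower R A N] [Module.Projective R N] : IsAdapted.{u} R A (P l) N :=
  have := hπ.finite l
  have := hπ.projective l
  .of_projective

theorem IsCover.hom_tensor_eq_zero (hπ : IsCover R π) {l : Λ} {N : Type v} [AddCommGroup N]
    [Module R N] [Module A N] [IsScalarTower R A N] [Module.Projective R N]
    (h : ∀ f : P l →ₗ[A] N, f = 0) (f : P l →ₗ[A] N ⊗[R] W) : f = 0 := by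
  obtain ⟨x, rfl⟩ := ((hπ.isAdapted l N).bijective W).2 f
  have : Subsingleton (P l →ₗ[A] N) := subsingleton_of_forall_eq 0 h
  rw [Subsingleton.elim x 0, map_zero]

theorem IsCover.cover_hom_eq_zero (hπ : IsCover R π) (h : IsSplitQuasiHereditary R A Δ) {l m : Λ}
    (hlm : ¬ l ≤ m) (f : P l →ₗ[A] Δ m) : f = 0 :=
  hπ.hom_eq_zero (fun _ hk => h.hom_eq_zero fun hkm => hlm (hk.trans hkm)) f

/-- A map `P l → Δ l` kills the kernel of `π l`, since there are no maps `Δ m → Δ l` for `m > l`.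
Hence `Hom(P l, Δ l) = End(Δ l) = R`. -/
theorem IsCover.generator_bijective (hπ : IsCover R π) (h : IsSplitQuasiHereditary R A Δ) (l : Λ) :
    Function.Bijective fun r : R => r • π l := by
  have hb := h.algebraMap_end_bijective l
  constructor
  · intro r s hrs
    refine hb.1 (comp_left_cancel (hπ.surjective l) ?_)
    ext x
    exact LinearMap.congr_fun hrs x
  · intro f
    obtain ⟨g, rfl⟩ := hπ.exists_comp_eq (fun m hm => h.hom_eq_zero hm.not_ge) f
    obtain ⟨r, rfl⟩ := hb.2 g
    exact ⟨r, rfl⟩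

/-- Maps out of `Δ l` embed into maps out of `P l`, and for `P l` coefficients can be pulled out of
Hom without any condition on Ext. -/
theorem IsCover.standard_tensor_eq_zero (hπ : IsCover R π) (h : IsSplitQuasiHereditary R A Δ)
    {l m : Λ} (hlm : ¬ l ≤ m) (f : Δ l →ₗ[A] Δ m ⊗[R] W) : f = 0 :=
  have := h.projective m
  hπ.standard_hom_eq_zero (hπ.hom_tensor_eq_zero (hπ.cover_hom_eq_zero h hlm)) f

/-- Maps `P l → Δ l ⊗ W` are uniquely of the form `x ↦ π x ⊗ w`. -/
theorem IsCover.tensor_bijective (hπ : IsCover R π) (h : IsSplitQuasiHereditary R A Δ) (l : Λ) :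
    Function.Bijective fun w : W => homTensor R A (P l) (Δ l) W (π l ⊗ₜ w) :=
  have := h.projective l
  ((hπ.isAdapted l (Δ l)).bijective W).comp
    (tmul_bijective_of_generator (hπ.generator_bijective h l))

end StandardHoms

/-! ### Base change of Hom -/

section HomBaseChange

variable {R S A M N : Type*} [CommRing R] [CommRing S] [Algebra R S] [Ring A] [Algebra R A]
  [AddCommGroup M] [Module R M] [Module A M] [IsScalarTower R A M]
  [AddCommGroup N] [Module R N] [Module A N] [IsScalarTower R A N]

@[simp]
theorem baseChangeMap_tmul (f : M →ₗ[A] N) (s : S) (m : M) :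
    baseChangeMap (R := R) (S := S) f (s ⊗ₜ m) = s ⊗ₜ f m := rfl

theorem comm_one_tmul_smul (a : A) (y : S ⊗[R] M) :
    TensorProduct.comm R S M ((1 ⊗ₜ[R] a : S ⊗[R] A) • y) = a • TensorProduct.comm R S M y := by
  induction y with
  | zero => simp
  | add x y hx hy => simp only [smul_add, map_add, hx, hy]
  | tmul s m => simp [tmul_smul_tmul, TensorProduct.smul_tmul']

/-- Restriction of a map `S ⊗ M → S ⊗ N` to `M`. -/
noncomputable def restrictBase (φ : S ⊗[R] M →ₗ[S ⊗[R] A] S ⊗[R] N) : M →ₗ[A] N ⊗[R] S where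
  toFun m := TensorProduct.comm R S N (φ (1 ⊗ₜ m))
  map_add' x y := by simp [TensorProduct.tmul_add]
  map_smul' a m := by
    rw [RingHom.id_apply, ← comm_one_tmul_smul, ← map_smul, tmul_smul_tmul, one_mul]

theorem restrictBase_apply (φ : S ⊗[R] M →ₗ[S ⊗[R] A] S ⊗[R] N) (m : M) :
    restrictBase φ m = TensorProduct.comm R S N (φ (1 ⊗ₜ m)) := rfl

theorem tmul_eq_smul_one_tmul (s : S) (m : M) :
    (s ⊗ₜ[R] m : S ⊗[R] M) = (s ⊗ₜ[R] (1 : A) : S ⊗[R] A) • (1 ⊗ₜ[R] m) := by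
  rw [tmul_smul_tmul, mul_one, one_smul]

/-- This is the adjunction between extension and restriction of scalars along `A → S ⊗ A`. The
tensor factors are swapped so that `S` appears as a coefficient module on the right. -/
theorem restrictBase_bijective :
    Function.Bijective
      (restrictBase : (S ⊗[R] M →ₗ[S ⊗[R] A] S ⊗[R] N) → (M →ₗ[A] N ⊗[R] S)) := by
  constructor
  · intro φ ψ h
    ext x
    induction x with
    | zero => simp
    | add x y hx hy => rw [map_add, map_add, hx, hy]
    | tmul s m =>
      rw [tmul_eq_smul_one_tmul (A := A), map_smul, map_smul]
      congr 1
      exact (TensorProduct.comm R S N).injective (LinearMap.congr_fun h m)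
  · intro ψ
    let ψ' : M →ₗ[R] S ⊗[R] N :=
      (TensorProduct.comm R S N).symm.toLinearMap ∘ₗ ψ.restrictScalars R
    have hψ : ∀ (a : A) (m : M), ψ' (a • m) = (1 ⊗ₜ[R] a : S ⊗[R] A) • ψ' m := by
      intro a m
      apply (TensorProduct.comm R S N).injective
      rw [comm_one_tmul_smul]
      simp [ψ']
    let φ : S ⊗[R] M →ₗ[S] S ⊗[R] N := ψ'.liftBaseChange S
    refine ⟨{ φ with map_smul' := ?_ }, ?_⟩
    · intro x y
      simp only [RingHom.id_apply, AddHom.toFun_eq_coe, LinearMap.coe_toAddHom]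
      induction x with
      | zero => simp
      | add x₁ x₂ h₁ h₂ => simp [add_smul, h₁, h₂]
      | tmul s a =>
        induction y with
        | zero => simp
        | add y₁ y₂ h₁ h₂ => simp only [smul_add, map_add, h₁, h₂]
        | tmul t m =>
          rw [tmul_smul_tmul]
          simp only [φ, LinearMap.liftBaseChange_tmul, hψ]
          generalize ψ' m = z
          induction z with
          | zero => simp
          | add z₁ z₂ h₁ h₂ => simp only [smul_add, h₁, h₂]
          | tmul r n => simp [tmul_smul_tmul, TensorProduct.smul_tmul', mul_assoc]
    · ext m
      simp [restrictBase_apply, φ, ψ']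

theorem restrictBase_homBaseChange (x : S ⊗[R] (M →ₗ[A] N)) :
    restrictBase (homBaseChange R S A M N x) =
      homTensor R A M N S (TensorProduct.comm R S (M →ₗ[A] N) x) := by
  induction x with
  | zero => ext; simp [restrictBase_apply]
  | add x y hx hy =>
    rw [map_add, map_add, map_add, ← hx, ← hy]
    ext
    simp [restrictBase_apply]
  | tmul s f =>
    ext m
    simp [restrictBase_apply, homBaseChange_tmul_tmul]

/-- Followed by the adjunction, the canonical map becomes `homTensor` with `W = S`. -/
theorem homBaseChange_bijective {R S A : Type u} {M N : Type v} [CommRing R] [CommRing S]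
    [Algebra R S] [Ring A] [Algebra R A]
    [AddCommGroup M] [Module R M] [Module A M] [IsScalarTower R A M]
    [AddCommGroup N] [Module R N] [Module A N] [IsScalarTower R A N]
    (h : IsAdapted.{u} R A M N) : Function.Bijective (homBaseChange R S A M N) := by
  rw [← restrictBase_bijective.of_comp_iff']
  have : restrictBase ∘ homBaseChange R S A M N =
      homTensor R A M N S ∘ TensorProduct.comm R S (M →ₗ[A] N) :=
    funext restrictBase_homBaseChange
  rw [this]
  exact (h.bijective S).comp (LinearEquiv.bijective _)

theorem exists_extend_baseChange {R S A : Type u} {M' M N : Type v} [CommRing R] [CommRing S]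
    [Algebra R S] [Ring A] [Algebra R A]
    [AddCommGroup M'] [Module R M'] [Module A M'] [IsScalarTower R A M']
    [AddCommGroup M] [Module R M] [Module A M] [IsScalarTower R A M]
    [AddCommGroup N] [Module R N] [Module A N] [IsScalarTower R A N] {f : M' →ₗ[A] M}
    (h : IsAdapted.{u} R A M' N)
    (hs : ∀ φ : M' →ₗ[A] N, ∃ ψ : M →ₗ[A] N, ψ ∘ₗ f = φ)
    (φ : S ⊗[R] M' →ₗ[S ⊗[R] A] S ⊗[R] N) :
    ∃ ψ : S ⊗[R] M →ₗ[S ⊗[R] A] S ⊗[R] N, ψ ∘ₗ baseChangeMap f = φ := by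
  obtain ⟨ψ, hψ⟩ := h.exists_extend hs (restrictBase φ)
  obtain ⟨ψ, rfl⟩ := restrictBase_bijective.2 ψ
  refine ⟨ψ, restrictBase_bijective.1 ?_⟩
  rw [← hψ]
  ext m
  simp [restrictBase_apply]

end HomBaseChange

/-! ### Exactness of base change -/

section Exactness

variable {R S A M' M M'' : Type*} [CommRing R] [CommRing S] [Algebra R S] [Ring A] [Algebra R A]
  [AddCommGroup M'] [Module R M'] [Module A M'] [IsScalarTower R A M']
  [AddCommGroup M] [Module R M] [Module A M] [IsScalarTower R A M]
  [AddCommGroup M''] [Module R M''] [Module A M''] [IsScalarTower R A M'']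
  {f : M' →ₗ[A] M} {g : M →ₗ[A] M''}

theorem baseChangeMap_eq_lTensor (f : M' →ₗ[A] M) (x : S ⊗[R] M') :
    baseChangeMap (R := R) (S := S) f x = (f.restrictScalars R).lTensor S x := rfl

theorem baseChangeMap_surjective (hg : Function.Surjective g) :
    Function.Surjective (baseChangeMap (R := R) (S := S) g) :=
  LinearMap.lTensor_surjective S (g := g.restrictScalars R) hg

theorem baseChangeMap_exact (hfg : Function.Exact f g) (hg : Function.Surjective g) :
    Function.Exact (baseChangeMap (R := R) (S := S) f) (baseChangeMap (R := R) (S := S) g) :=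
  lTensor_exact S (f := f.restrictScalars R) (g := g.restrictScalars R) hfg hg

theorem baseChangeMap_injective [Module.Projective R M''] (hf : Function.Injective f)
    (hfg : Function.Exact f g) (hg : Function.Surjective g) :
    Function.Injective (baseChangeMap (R := R) (S := S) f) := by
  have h := (rTensor_injective_of_exact (i := f.restrictScalars R) (p := g.restrictScalars R)
    hf hfg hg S).1
  intro x y hxy
  apply (TensorProduct.comm R S M').injective
  apply h
  rw [← LinearMap.comm_comp_lTensor_comp_comm_eq]
  simpa [baseChangeMap_eq_lTensor] using hxy

/-- Base change of an isomorphism of `A`-modules. -/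
noncomputable def baseChangeEquiv (e : M' ≃ₗ[A] M) : S ⊗[R] M' ≃ₗ[S ⊗[R] A] S ⊗[R] M :=
  LinearEquiv.ofBijective (baseChangeMap e.toLinearMap)
    (LinearEquiv.bijective ((e.restrictScalars R).lTensor S))

theorem IsSumRetract.baseChange (h : IsSumRetract A M M') :
    IsSumRetract (S ⊗[R] A) (S ⊗[R] M) (S ⊗[R] M') := by
  obtain ⟨n, i, p, h⟩ := h
  refine ⟨n, fun k => baseChangeMap (i k), fun k => baseChangeMap (p k), fun x => ?_⟩
  induction x with
  | zero => simp
  | add x y hx hy => simp only [map_add, Finset.sum_add_distrib, hx, hy]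
  | tmul s m => simp [← TensorProduct.tmul_sum, h]

variable (R S A) in
/-- The regular module `S ⊗ A` is the base change of the regular module `A`. -/
theorem baseChangeAction_self (x y : S ⊗[R] A) : baseChangeAction R S A A x y = x * y := by
  induction x with
  | zero => simp
  | add x₁ x₂ h₁ h₂ => rw [map_add, LinearMap.add_apply, add_mul, h₁, h₂]
  | tmul s a =>
    induction y with
    | zero => simp
    | add y₁ y₂ h₁ h₂ => rw [map_add, mul_add, h₁, h₂]
    | tmul t b =>
      change s • (t ⊗ₜ[R] (a • b) : S ⊗[R] A) = _
      rw [Algebra.TensorProduct.tmul_mul_tmul, TensorProduct.smul_tmul', smul_eq_mul, smul_eq_mul]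

end Exactness

/-! ### Base change of filtrations -/

section BaseChangeFiltration

/-- `S ⊗ (M ⊗ U) = (S ⊗ M) ⊗ (S ⊗ U)` as modules over `S ⊗ A`. -/
noncomputable def distribBaseChangeEquiv (R S A M U : Type*) [CommRing R] [CommRing S] [Algebra R S]
    [Ring A] [Algebra R A] [AddCommGroup M] [Module R M] [Module A M] [IsScalarTower R A M]
    [AddCommGroup U] [Module R U] :
    S ⊗[R] (M ⊗[R] U) ≃ₗ[S ⊗[R] A] (S ⊗[R] M) ⊗[S] (S ⊗[R] U) where
  __ := TensorProduct.AlgebraTensorModule.distribBaseChange R S M U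
  map_smul' x y := by
    simp only [RingHom.id_apply, AddHom.toFun_eq_coe, LinearMap.coe_toAddHom, LinearEquiv.coe_coe]
    induction x with
    | zero => simp
    | add x₁ x₂ h₁ h₂ => simp only [add_smul, map_add, h₁, h₂]
    | tmul s a =>
      induction y with
      | zero => simp
      | add y₁ y₂ h₁ h₂ => simp only [smul_add, map_add, h₁, h₂]
      | tmul t z =>
        induction z with
        | zero => simp
        | add z₁ z₂ h₁ h₂ => simp only [TensorProduct.tmul_add, smul_add, map_add, h₁, h₂]
        | tmul m v =>
          rw [tmul_smul_tmul, TensorProduct.smul_tmul']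
          simp [TensorProduct.smul_tmul', tmul_smul_tmul]

variable {R S A : Type u} [CommRing R] [CommRing S] [Algebra R S] [Ring A] [Algebra R A]
  {Λ : Type w} {Θ : Λ → Type u}
  [∀ l, AddCommGroup (Θ l)] [∀ l, Module R (Θ l)] [∀ l, Module A (Θ l)]
  [∀ l, IsScalarTower R A (Θ l)] {Γ : Set Λ}
  {M : Type u} [AddCommGroup M] [Module R M] [Module A M] [IsScalarTower R A M]

/-- The factors `Θ m ⊗ U` are `R`-projective, so each step stays exact; the new factor is `(S ⊗ Θ m)
⊗_S (S ⊗ U)`. -/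
theorem IsFilteredBy.baseChange (hΘ : ∀ m ∈ Γ, Module.Projective R (Θ m))
    (h : IsFilteredBy R A Θ Γ M) :
    IsFilteredBy S (S ⊗[R] A) (fun l => S ⊗[R] Θ l) Γ (S ⊗[R] M) := by
  refine IsFilteredBy.induction (R := R)
    (fun M => IsFilteredBy S (S ⊗[R] A) (fun l => S ⊗[R] Θ l) Γ (S ⊗[R] M)) ?_ ?_ h
  · intro M _ _ _ _ _
    have : Subsingleton (S ⊗[R] M) := inferInstance
    exact .of_subsingleton _
  · intro M' M _ _ _ _ _ _ _ _ U _ _ _ _ f m g hm hf hfg hg ih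
    have := hΘ m hm
    let e := distribBaseChangeEquiv R S A (Θ m) U
    refine ih.of_exact (U := S ⊗[R] U) (Θ := fun l => S ⊗[R] Θ l) hm (baseChangeMap f)
      (e.toLinearMap ∘ₗ baseChangeMap g) (baseChangeMap_injective hf hfg hg) ?_
      (e.surjective.comp (baseChangeMap_surjective hg))
    intro x
    rw [LinearMap.comp_apply, LinearEquiv.coe_coe, LinearEquiv.map_eq_zero_iff]
    exact baseChangeMap_exact hfg hg x

end BaseChangeFiltration

/-! ### Base change of split quasi-hereditary algebras -/

section BaseChangeCover

variable {R S A : Type u} [CommRing R] [CommRing S] [Algebra R S] [Ring A] [Algebra R A]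
  {M N : Type*} [AddCommGroup M] [Module R M] [Module A M] [IsScalarTower R A M]
  [AddCommGroup N] [Module R N] [Module A N] [IsScalarTower R A N]

/-- The action is written out as `baseChangeAction` because `S ⊗ A` carries two module structures
over itself: multiplication, and the base change of the regular module. `baseChangeAction_self`
identifies them. -/
theorem baseChange_smul (f : M →ₗ[A] N) (x : S ⊗[R] A) (y : S ⊗[R] M) :
    (f.restrictScalars R).baseChange S (x • y) =
      baseChangeAction R S A N x ((f.restrictScalars R).baseChange S y) :=
  (baseChangeMap f).map_smul x y

/-- Base change of an `A`-linear form. -/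
noncomputable def baseChangeForm (φ : M →ₗ[A] A) : S ⊗[R] M →ₗ[S ⊗[R] A] S ⊗[R] A where
  toFun x := (φ.restrictScalars R).baseChange S x
  map_add' := map_add _
  map_smul' x y := (baseChange_smul φ x y).trans (baseChangeAction_self R S A x _)

theorem baseChangeForm_tmul (φ : M →ₗ[A] A) (s : S) (m : M) :
    baseChangeForm (R := R) φ (s ⊗ₜ m) = s ⊗ₜ φ m := rfl

theorem baseChange_finite_projective [Module.Finite A M] [Module.Projective A M] :
    Module.Finite (S ⊗[R] A) (S ⊗[R] M) ∧ Module.Projective (S ⊗[R] A) (S ⊗[R] M) := by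
  obtain ⟨n, x, φ, h⟩ := exists_dual_basis A M
  refine IsSumRetract.finite_projective (M' := S ⊗[R] A)
    ⟨n, fun k => baseChangeForm (φ k), fun k => LinearMap.toSpanSingleton _ _ (1 ⊗ₜ x k),
      fun y => ?_⟩
  induction y with
  | zero => simp
  | add x y hx hy => simp only [map_add, Finset.sum_add_distrib, hx, hy]
  | tmul s m =>
    simp [baseChangeForm_tmul, tmul_smul_tmul, ← TensorProduct.tmul_sum, h]

theorem Generates.baseChange {Λ : Type*} {P : Λ → Type*} [∀ l, AddCommGroup (P l)]
    [∀ l, Module R (P l)] [∀ l, Module A (P l)] [∀ l, IsScalarTower R A (P l)]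
    (h : Generates A P) : Generates (S ⊗[R] A) (fun l => S ⊗[R] P l) := by
  obtain ⟨n, ν, a, x, h⟩ := h
  refine ⟨n, ν, fun k => baseChangeForm (a k), fun k => 1 ⊗ₜ x k, ?_⟩
  simp only [baseChangeForm_tmul, ← TensorProduct.tmul_sum, h]
  rfl

variable {Λ : Type w} [PartialOrder Λ] {Δ P : Λ → Type u}
  [∀ l, AddCommGroup (Δ l)] [∀ l, Module R (Δ l)] [∀ l, Module A (Δ l)]
  [∀ l, IsScalarTower R A (Δ l)]
  [∀ l, AddCommGroup (P l)] [∀ l, Module R (P l)] [∀ l, Module A (P l)]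
  [∀ l, IsScalarTower R A (P l)] {π : ∀ l, P l →ₗ[A] Δ l}

/-- The kernel of the base change of a surjection onto an `R`-projective module. -/
noncomputable def kerBaseChangeEquiv [Module.Projective R N] (g : M →ₗ[A] N)
    (hg : Function.Surjective g) :
    S ⊗[R] LinearMap.ker g ≃ₗ[S ⊗[R] A] LinearMap.ker (baseChangeMap (R := R) (S := S) g) :=
  (LinearEquiv.ofInjective (baseChangeMap (LinearMap.ker g).subtype)
    (baseChangeMap_injective (Submodule.injective_subtype _)
      (LinearMap.exact_subtype_ker_map g) hg)).trans
    (LinearEquiv.ofEq _ _ (LinearMap.exact_iff.mp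
      (baseChangeMap_exact (LinearMap.exact_subtype_ker_map g) hg)).symm)

theorem IsCover.baseChange (hπ : IsCover R π) (hΔ : ∀ l, Module.Projective R (Δ l)) :
    IsCover S (fun l => baseChangeMap (R := R) (S := S) (π l)) where
  finite l := have := hπ.finite l; have := hπ.projective l; baseChange_finite_projective.1
  projective l := have := hπ.finite l; have := hπ.projective l; baseChange_finite_projective.2
  surjective l := baseChangeMap_surjective (hπ.surjective l)
  filtered l := ((hπ.filtered l).baseChange fun m _ => hΔ m).congr
    (kerBaseChangeEquiv (π l) (hπ.surjective l))
  generates := hπ.generates.baseChange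

/-- By the adjunction, maps from `S ⊗ Δ l` to `S ⊗ Δ m` are maps `Δ l → Δ m ⊗ S`. Composing these
with `π l` reduces the order condition and `End = S` to the computation of `Hom(P l, Δ m ⊗ S)`. -/
theorem IsSplitQuasiHereditary.baseChange [Finite Λ] (h : IsSplitQuasiHereditary R A Δ) :
    IsSplitQuasiHereditary S (S ⊗[R] A) (fun l => S ⊗[R] Δ l) := by
  obtain ⟨P, _, _, _, _, π, hπ⟩ := h.exists_cover
  have := h.finite_algebra
  have := h.projective_algebra
  refine .of_cover (hπ.baseChange h.projective) inferInstance inferInstance (fun l => ?_)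
    (fun l => ?_) ?_ ?_
  · have := h.finite l
    have : Module.Finite R (Δ l) := Module.Finite.trans A _
    exact Module.Finite.of_restrictScalars_finite S _ _
  · have := h.projective l
    infer_instance
  · intro l m hlm f
    apply restrictBase_bijective.1
    rw [hπ.standard_tensor_eq_zero h hlm (restrictBase f)]
    ext
    simp [restrictBase_apply]
  · intro l
    constructor
    · rw [injective_iff_map_eq_zero]
      intro s hs
      refine (hπ.tensor_bijective (W := S) h l).1 ?_
      ext x
      have := LinearMap.congr_fun hs (1 ⊗ₜ π l x)
      rw [Module.algebraMap_end_apply, TensorProduct.smul_tmul', smul_eq_mul, mul_one] at this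
      have := congrArg (TensorProduct.comm R S (Δ l)) this
      simpa using this
    · intro φ
      obtain ⟨s, hs⟩ := (hπ.tensor_bijective (W := S) h l).2 (restrictBase φ ∘ₗ π l)
      refine ⟨s, restrictBase_bijective.1 (comp_left_cancel (hπ.surjective l) ?_)⟩
      rw [← hs]
      ext x
      simp [restrictBase_apply, Module.algebraMap_end_apply, TensorProduct.smul_tmul']

end BaseChangeCover

/-! ### Transport along an isomorphism of algebras -/

section Transport

variable {R A B : Type u} [CommRing R] [Ring A] [Algebra R A] [Ring B] [Algebra R B]
  {σ : A →+* B} {σ' : B →+* A} [RingHomInvPair σ σ'] [RingHomInvPair σ' σ]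

variable (σ') in
/-- The identity map, as a semilinear equivalence onto the module twisted by an isomorphism. -/
def twistEquiv (M : Type*) [AddCommGroup M] [Module A M] :
    letI : Module B M := Module.compHom M σ'
    M ≃ₛₗ[σ] M :=
  letI : Module B M := Module.compHom M σ'
  { AddEquiv.refl M with
    map_smul' := fun a x => by
      change a • x = σ' (σ a) • x
      rw [RingHomInvPair.comp_apply_eq] }

variable {M N M' N' : Type*} [AddCommGroup M] [Module A M] [AddCommGroup N] [Module A N]
  [AddCommGroup M'] [Module B M'] [AddCommGroup N'] [Module B N']

/-- Conjugation of a linear map by semilinear equivalences. -/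
def conjMap (d : M ≃ₛₗ[σ] M') (d' : N ≃ₛₗ[σ] N') (φ : M →ₗ[A] N) : M' →ₗ[B] N' :=
  d'.toLinearMap.comp (φ.comp d.symm.toLinearMap)

theorem conjMap_apply (d : M ≃ₛₗ[σ] M') (d' : N ≃ₛₗ[σ] N') (φ : M →ₗ[A] N) (x : M') :
    conjMap d d' φ x = d' (φ (d.symm x)) := rfl

theorem conjMap_surjective (d : M ≃ₛₗ[σ] M') (d' : N ≃ₛₗ[σ] N') {φ : M →ₗ[A] N}
    (hφ : Function.Surjective φ) : Function.Surjective (conjMap d d' φ) :=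
  d'.surjective.comp (hφ.comp d.symm.surjective)

theorem conjMap_injective (d : M ≃ₛₗ[σ] M') (d' : N ≃ₛₗ[σ] N') {φ : M →ₗ[A] N}
    (hφ : Function.Injective φ) : Function.Injective (conjMap d d' φ) :=
  d'.injective.comp (hφ.comp d.symm.injective)

theorem conjMap_exact {L L' : Type*} [AddCommGroup L] [Module A L] [AddCommGroup L'] [Module B L']
    (c : L ≃ₛₗ[σ] L') (d : M ≃ₛₗ[σ] M') (d' : N ≃ₛₗ[σ] N') {f : L →ₗ[A] M} {g : M →ₗ[A] N}
    (h : Function.Exact f g) : Function.Exact (conjMap c d f) (conjMap d d' g) := by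
  intro x
  rw [conjMap_apply, LinearEquiv.map_eq_zero_iff, h]
  constructor
  · rintro ⟨y, hy⟩
    exact ⟨c y, by simp [conjMap_apply, hy]⟩
  · rintro ⟨y, rfl⟩
    exact ⟨c.symm y, by simp [conjMap_apply]⟩

theorem map_smul_of_algebraMap [Module R M] [IsScalarTower R A M] [Module R M']
    [IsScalarTower R B M'] (hσ : ∀ r, σ (algebraMap R A r) = algebraMap R B r) (d : M ≃ₛₗ[σ] M')
    (r : R) (x : M) : d (r • x) = r • d x := by
  rw [← algebraMap_smul A r x, d.map_smulₛₗ, hσ, algebraMap_smul]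

/-- A semilinear equivalence is linear over the base ring. -/
def restrictEquiv [Module R M] [IsScalarTower R A M] [Module R M']
    [IsScalarTower R B M'] (hσ : ∀ r, σ (algebraMap R A r) = algebraMap R B r)
    (d : M ≃ₛₗ[σ] M') : M ≃ₗ[R] M' :=
  { d.toAddEquiv with map_smul' := map_smul_of_algebraMap hσ d }

/-- The semilinear equivalence `M ⊗ U ≃ M' ⊗ U` induced by a semilinear equivalence `M ≃ M'`. -/
noncomputable def tensorSemiEquiv [Module R M] [IsScalarTower R A M] [Module R M']
    [IsScalarTower R B M'] (hσ : ∀ r, σ (algebraMap R A r) = algebraMap R B r)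
    (d : M ≃ₛₗ[σ] M') (U : Type*) [AddCommGroup U] [Module R U] : M ⊗[R] U ≃ₛₗ[σ] M' ⊗[R] U :=
  { (TensorProduct.congr (restrictEquiv hσ d) (LinearEquiv.refl R U)).toAddEquiv with
    map_smul' := fun a x => by
      change TensorProduct.congr (restrictEquiv hσ d) (LinearEquiv.refl R U) (a • x) =
        σ a • TensorProduct.congr (restrictEquiv hσ d) (LinearEquiv.refl R U) x
      induction x with
      | zero => simp
      | add x y hx hy => simp only [smul_add, map_add, hx, hy]
      | tmul m v =>
        simp only [TensorProduct.smul_tmul', TensorProduct.congr_tmul]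
        congr 1
        exact d.map_smulₛₗ a m }

variable {Λ : Type w} {Θ Θ' : Λ → Type u}
  [∀ l, AddCommGroup (Θ l)] [∀ l, Module R (Θ l)] [∀ l, Module A (Θ l)]
  [∀ l, IsScalarTower R A (Θ l)] [∀ l, AddCommGroup (Θ' l)] [∀ l, Module R (Θ' l)]
  [∀ l, Module B (Θ' l)] [∀ l, IsScalarTower R B (Θ' l)] {Γ : Set Λ}

theorem IsFilteredBy.transport {M M' : Type u} [AddCommGroup M] [Module R M] [Module A M]
    [IsScalarTower R A M] [AddCommGroup M'] [Module B M']
    (hσ : ∀ r, σ (algebraMap R A r) = algebraMap R B r) (d : ∀ l, Θ l ≃ₛₗ[σ] Θ' l)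
    (h : IsFilteredBy R A Θ Γ M) (dM : M ≃ₛₗ[σ] M') : IsFilteredBy R B Θ' Γ M' := by
  refine IsFilteredBy.induction (R := R) (fun M => ∀ (M' : Type u) [AddCommGroup M'] [Module B M']
    (_ : M ≃ₛₗ[σ] M'), IsFilteredBy R B Θ' Γ M') ?_ ?_ h M' dM
  · intro M _ _ _ _ _ M' _ _ dM
    have := dM.symm.toEquiv.subsingleton
    exact .of_subsingleton _
  · intro L M _ _ _ _ _ _ _ _ U _ _ _ _ f m g hm hf hfg hg ih M' _ _ dM
    -- The submodule has no given counterpart over `B`; its own twist by `σ'` serves as one.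
    let _ : Module B L := Module.compHom L σ'
    let c : L ≃ₛₗ[σ] L := twistEquiv σ' L
    exact (ih L c).of_exact hm (conjMap c dM f) (conjMap dM (tensorSemiEquiv hσ (d m) U) g)
      (conjMap_injective _ _ hf) (conjMap_exact _ _ _ hfg) (conjMap_surjective _ _ hg)

variable [PartialOrder Λ]

theorem IsSplitQuasiHereditary.transport [Finite Λ] (e : A ≃ₐ[R] B)
    (hσ : ∀ a, σ a = e a) (d : ∀ l, Θ l ≃ₛₗ[σ] Θ' l)
    (h : IsSplitQuasiHereditary R A Θ) : IsSplitQuasiHereditary R B Θ' := by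
  have hσ' : ∀ r, σ (algebraMap R A r) = algebraMap R B r := fun r => by rw [hσ, e.commutes]
  obtain ⟨P, _, _, _, _, π, hπ⟩ := h.exists_cover
  have hA := h.finite_algebra
  have := h.projective_algebra
  have hB : Module.Finite R B := Module.Finite.equiv e.toLinearEquiv
  let _ : ∀ l, Module B (P l) := fun l => Module.compHom (P l) σ'
  let c : ∀ l, P l ≃ₛₗ[σ] P l := fun l => twistEquiv σ' (P l)
  have : ∀ l, IsScalarTower R B (P l) := fun l => .of_algebraMap_smul fun r x => by
    change σ' (algebraMap R B r) • x = r • x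
    rw [← hσ', RingHomInvPair.comp_apply_eq, algebraMap_smul]
  have hcov : IsCover R (fun l => conjMap (c l) (d l) (π l)) := by
    refine ⟨fun l => ?_, fun l => ?_, fun l => conjMap_surjective _ _ (hπ.surjective l),
      fun l => ?_, ?_⟩
    · have := hπ.finite l
      have : Module.Finite R (P l) := Module.Finite.trans A _
      exact Module.Finite.of_restrictScalars_finite R _ _
    · have := hπ.projective l
      exact Module.Projective.of_equiv (c l)
    · let _ : Module B (LinearMap.ker (π l)) := Module.compHom _ σ'
      let k : LinearMap.ker (π l) ≃ₛₗ[σ] LinearMap.ker (π l) := twistEquiv σ' _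
      refine ((hπ.filtered l).transport hσ' d k).congr ?_
      refine (LinearEquiv.ofInjective (conjMap k (c l) (LinearMap.ker (π l)).subtype)
        (conjMap_injective _ _ (Submodule.injective_subtype _))).trans
        (LinearEquiv.ofEq _ _ (LinearMap.exact_iff.mp ?_).symm)
      exact conjMap_exact k (c l) (d l) (LinearMap.exact_subtype_ker_map (π l))
    · obtain ⟨n, ν, a, x, hx⟩ := hπ.generates
      let s : A ≃ₛₗ[σ] B := { e.toAddEquiv with
        map_smul' := fun a b => by
          change e (a * b) = σ a * e b
          rw [hσ, map_mul] }
      refine ⟨n, ν, fun k => conjMap (c (ν k)) s (a k), x, ?_⟩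
      change ∑ k, e (a k (x k)) = 1
      rw [← map_sum, hx, map_one]
  refine .of_cover hcov hB (Module.Projective.of_equiv' e.toLinearEquiv) (fun l => ?_)
    (fun l => ?_) ?_ ?_
  · have := h.finite l
    have : Module.Finite R (Θ l) := Module.Finite.trans A _
    have : Module.Finite R (Θ' l) := Module.Finite.equiv (restrictEquiv hσ' (d l))
    exact Module.Finite.of_restrictScalars_finite R _ _
  · have := h.projective l
    exact Module.Projective.of_equiv' (restrictEquiv hσ' (d l))
  · intro l m hlm f
    have h0 := h.hom_eq_zero hlm (conjMap (d l).symm (d m).symm f)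
    ext x
    have := LinearMap.congr_fun h0 ((d l).symm x)
    simpa [conjMap_apply] using this
  · intro l
    have hb := h.algebraMap_end_bijective l
    constructor
    · intro r s hrs
      refine hb.1 (LinearMap.ext fun x => (d l).injective ?_)
      have := LinearMap.congr_fun hrs (d l x)
      simp only [Module.algebraMap_end_apply] at this ⊢
      rwa [map_smul_of_algebraMap hσ', map_smul_of_algebraMap hσ']
    · intro f
      obtain ⟨r, hr⟩ := hb.2 (conjMap (d l).symm (d l).symm f)
      refine ⟨r, LinearMap.ext fun x => ?_⟩
      have := congrArg (d l) (LinearMap.congr_fun hr ((d l).symm x))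
      rw [Module.algebraMap_end_apply, map_smul_of_algebraMap hσ'] at this
      simpa [conjMap_apply] using this

end Transport

/-! ### Base change of the dual -/

section DualBaseChange

variable (R S A M : Type*) [CommRing R] [CommRing S] [Algebra R S] [Ring A] [Algebra R A]
  [AddCommGroup M] [Module R M] [Module A M] [IsScalarTower R A M]

/-- The isomorphism `S ⊗ Aᵒᵖ ≃ (S ⊗ A)ᵒᵖ`. -/
noncomputable def baseChangeOpEquiv : S ⊗[R] Aᵐᵒᵖ ≃ₐ[S] (S ⊗[R] A)ᵐᵒᵖ :=
  (Algebra.TensorProduct.congr (AlgEquiv.toOpposite S S) AlgEquiv.refl).trans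
    (Algebra.TensorProduct.opAlgEquiv R S S A)

theorem baseChangeOpEquiv_tmul (s : S) (a : Aᵐᵒᵖ) :
    baseChangeOpEquiv R S A (s ⊗ₜ a) = MulOpposite.op (s ⊗ₜ a.unop) := rfl

theorem StdDual.ext {f g : StdDual R M} (h : ∀ m, f.toLin m = g.toLin m) : f = g :=
  LinearMap.ext h

theorem StdDual.smul_toLin (r : R) (f : StdDual R M) (m : M) :
    (r • f).toLin m = r * f.toLin m := rfl

theorem StdDual.sum_toLin {ι : Type*} (s : Finset ι) (f : ι → StdDual R M) (m : M) :
    (∑ k ∈ s, f k).toLin m = ∑ k ∈ s, (f k).toLin m :=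
  LinearMap.sum_apply _ _ _

theorem exists_std_dual_basis (R M : Type*) [CommRing R] [AddCommGroup M] [Module R M]
    [Module.Finite R M] [Module.Projective R M] :
    ∃ (n : ℕ) (x : Fin n → M) (φ : Fin n → StdDual R M),
      (∀ m, ∑ k, (φ k).toLin m • x k = m) ∧ ∀ f : StdDual R M, ∑ k, f.toLin (x k) • φ k = f := by
  obtain ⟨n, x, φ₀, h⟩ := exists_dual_basis R M
  let φ : Fin n → StdDual R M := φ₀
  replace h : ∀ m, ∑ k, (φ k).toLin m • x k = m := h
  refine ⟨n, x, φ, h, fun f => StdDual.ext R M fun m => ?_⟩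
  conv_rhs => rw [← h m, map_sum]
  rw [StdDual.sum_toLin]
  refine Finset.sum_congr rfl fun k _ => ?_
  rw [map_smul, smul_eq_mul, mul_comm, StdDual.smul_toLin]

/-- The canonical map `S ⊗ D M → D (S ⊗ M)`. -/
noncomputable def dualBaseChangeMap : S ⊗[R] StdDual R M →ₗ[S] StdDual S (S ⊗[R] M) :=
  (LinearMap.liftBaseChange S (Module.Dual.baseChange (V := M) S) :
    S ⊗[R] Module.Dual R M →ₗ[S] Module.Dual S (S ⊗[R] M))

variable {R S M} in
theorem dualBaseChangeMap_tmul_tmul (s t : S) (φ : StdDual R M) (m : M) :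
    (dualBaseChangeMap R S M (s ⊗ₜ φ)).toLin (t ⊗ₜ m) = s * (t * algebraMap R S (φ.toLin m)) := by
  have h : dualBaseChangeMap R S M (s ⊗ₜ φ) =
      (s • Module.Dual.baseChange (V := M) S φ : Module.Dual S (S ⊗[R] M)) :=
    LinearMap.liftBaseChange_tmul S (Module.Dual.baseChange (V := M) S) s φ.toLin
  rw [h]
  exact congrArg (s * ·) ((Module.Dual.baseChange_apply_tmul S φ.toLin t m).trans
    ((Algebra.smul_def _ _).trans (mul_comm _ _)))

theorem dualBaseChangeMap_bijective [Module.Finite R M] [Module.Projective R M] :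
    Function.Bijective (dualBaseChangeMap R S M) := by
  obtain ⟨n, x, φ, h, h'⟩ := exists_std_dual_basis R M
  -- The inverse is expansion of a form in the dual basis.
  let ψ : StdDual S (S ⊗[R] M) → S ⊗[R] StdDual R M := fun f => ∑ k, f.toLin (1 ⊗ₜ x k) ⊗ₜ[R] φ k
  have hadd : ∀ f g, ψ (f + g) = ψ f + ψ g := fun f g => by
    rw [← Finset.sum_add_distrib]
    exact Finset.sum_congr rfl fun k _ => TensorProduct.add_tmul _ _ _
  have h₁ : ∀ y, ψ (dualBaseChangeMap R S M y) = y := by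
    intro y
    induction y with
    | zero =>
      rw [map_zero]
      exact Finset.sum_eq_zero fun k _ => TensorProduct.zero_tmul _ _
    | add x y hx hy => rw [map_add, hadd, hx, hy]
    | tmul s f =>
      conv_rhs => rw [← h' f, TensorProduct.tmul_sum]
      refine Finset.sum_congr rfl fun k _ => ?_
      rw [dualBaseChangeMap_tmul_tmul, one_mul, TensorProduct.tmul_smul,
        TensorProduct.smul_tmul', ← Algebra.commutes, Algebra.smul_def]
  have h₂ : ∀ f, dualBaseChangeMap R S M (ψ f) = f := by
    intro f
    refine StdDual.ext S _ fun y => ?_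
    induction y with
    | zero => rw [map_zero, map_zero]
    | add x y hx hy => rw [map_add, map_add, hx, hy]
    | tmul s m =>
      have hm : (s ⊗ₜ[R] m : S ⊗[R] M) =
          ∑ k, (s * algebraMap R S ((φ k).toLin m)) • (1 ⊗ₜ[R] x k) := by
        conv_lhs => rw [← h m, TensorProduct.tmul_sum]
        refine Finset.sum_congr rfl fun k _ => ?_
        rw [TensorProduct.smul_tmul', smul_eq_mul, mul_one, TensorProduct.tmul_smul,
          TensorProduct.smul_tmul', Algebra.smul_def, mul_comm]
      conv_rhs => rw [hm, map_sum]
      rw [map_sum, StdDual.sum_toLin]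
      refine Finset.sum_congr rfl fun k _ => ?_
      rw [dualBaseChangeMap_tmul_tmul, map_smul, smul_eq_mul, mul_comm]
  exact ⟨Function.LeftInverse.injective h₁, Function.RightInverse.surjective h₂⟩

theorem dualBaseChangeMap_smul (a : S ⊗[R] Aᵐᵒᵖ) (f : S ⊗[R] StdDual R M) :
    dualBaseChangeMap R S M (a • f) = baseChangeOpEquiv R S A a • dualBaseChangeMap R S M f := by
  induction a with
  | zero =>
    have h0 : (0 : S ⊗[R] Aᵐᵒᵖ) • f = 0 := zero_smul (S ⊗[R] Aᵐᵒᵖ) f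
    have h1 : (0 : (S ⊗[R] A)ᵐᵒᵖ) • dualBaseChangeMap R S M f = 0 := zero_smul _ _
    rw [map_zero, h1, ← map_zero (dualBaseChangeMap R S M), ← h0]
  | add a b ha hb => rw [add_smul, map_add, map_add, add_smul, ha, hb]
  | tmul s a =>
    induction f with
    | zero => rw [smul_zero, map_zero, smul_zero]
    | add f g hf hg => rw [smul_add, map_add, map_add, smul_add, hf, hg]
    | tmul t f =>
      refine StdDual.ext S _ fun y => ?_
      rw [dual_smul_apply, baseChangeOpEquiv_tmul, MulOpposite.unop_op]
      induction y with
      | zero => simp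
      | add x y hx hy => rw [smul_add, map_add, map_add, hx, hy]
      | tmul r m =>
        rw [tmul_smul_tmul, tmul_smul_tmul, dualBaseChangeMap_tmul_tmul,
          dualBaseChangeMap_tmul_tmul, dual_smul_apply]
        ring

variable {R S A}

theorem IsSplitQuasiHereditary.dual_baseChange {R S A : Type u} [CommRing R] [CommRing S]
    [Algebra R S] [Ring A] [Algebra R A] {Λ : Type w} [Finite Λ] [PartialOrder Λ]
    {C : Λ → Type u} [∀ l, AddCommGroup (C l)] [∀ l, Module R (C l)] [∀ l, Module A (C l)]
    [∀ l, IsScalarTower R A (C l)] (hf : ∀ l, Module.Finite R (C l))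
    (hp : ∀ l, Module.Projective R (C l))
    (h : IsSplitQuasiHereditary R Aᵐᵒᵖ (fun l => StdDual R (C l))) :
    IsSplitQuasiHereditary S (S ⊗[R] A)ᵐᵒᵖ (fun l => StdDual S (S ⊗[R] C l)) := by
  let e := baseChangeOpEquiv R S A
  have := RingHomInvPair.of_ringEquiv (e : S ⊗[R] Aᵐᵒᵖ ≃+* (S ⊗[R] A)ᵐᵒᵖ)
  have := RingHomInvPair.symm
    ((e : S ⊗[R] Aᵐᵒᵖ ≃+* (S ⊗[R] A)ᵐᵒᵖ) : S ⊗[R] Aᵐᵒᵖ →+* (S ⊗[R] A)ᵐᵒᵖ)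
    ((e : S ⊗[R] Aᵐᵒᵖ ≃+* (S ⊗[R] A)ᵐᵒᵖ).symm : (S ⊗[R] A)ᵐᵒᵖ →+* S ⊗[R] Aᵐᵒᵖ)
  refine (h.baseChange (S := S)).transport
    (σ := ((e : S ⊗[R] Aᵐᵒᵖ ≃+* (S ⊗[R] A)ᵐᵒᵖ) : S ⊗[R] Aᵐᵒᵖ →+* (S ⊗[R] A)ᵐᵒᵖ))
    (σ' := ((e : S ⊗[R] Aᵐᵒᵖ ≃+* (S ⊗[R] A)ᵐᵒᵖ).symm : (S ⊗[R] A)ᵐᵒᵖ →+* S ⊗[R] Aᵐᵒᵖ))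
    e (fun a => rfl) fun l => ?_
  exact
    { AddEquiv.ofBijective (dualBaseChangeMap R S (C l)) (dualBaseChangeMap_bijective R S (C l)) with
      map_smul' := fun a f => dualBaseChangeMap_smul R S A (C l) a f }

end DualBaseChange

/-! ### Base change of costandard modules -/

section Costandard

variable {R S A : Type u} [CommRing R] [CommRing S] [Algebra R S] [Ring A] [Algebra R A]
  {Λ : Type w} [Finite Λ] [PartialOrder Λ]
  {Δ : Λ → Type u} [∀ l, AddCommGroup (Δ l)] [∀ l, Module R (Δ l)] [∀ l, Module A (Δ l)]
  [∀ l, IsScalarTower R A (Δ l)]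
  {C : Λ → Type u} [∀ l, AddCommGroup (C l)] [∀ l, Module R (C l)] [∀ l, Module A (C l)]
  [∀ l, IsScalarTower R A (C l)]
  (hA : IsSplitQuasiHereditary R A Δ) (hC : IsCostandard R A Δ C)

include hA hC

theorem isAdapted_of_filtered {M N : Type u} [AddCommGroup M] [Module R M] [Module A M]
    [IsScalarTower R A M] [AddCommGroup N] [Module R N] [Module A N] [IsScalarTower R A N]
    (hM : IsFilteredBy R A Δ Set.univ M) (hN : IsFilteredBy R A C Set.univ N) :
    IsAdapted.{u} R A M N := by
  obtain ⟨P, _, _, _, _, π, hπ⟩ := hA.exists_cover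
  have hE : ∀ l, ExtZero A (Δ l) N 1 := fun l =>
    hN.extZero_right fun m _ => hC.ext_pos l m 1 one_pos
  have := hN.projective fun m _ => hC.projective m
  exact hM.isAdapted (fun l _ => isAdapted_standard hπ hE l) fun l _ => hE l

theorem isAdapted_costandard (l m : Λ) : IsAdapted.{u} R A (Δ l) (C m) := by
  obtain ⟨P, _, _, _, _, π, hπ⟩ := hA.exists_cover
  have := hC.projective m
  exact isAdapted_standard hπ (fun l => hC.ext_pos l m 1 one_pos) l

/-- Descending induction on `l` with dimension shifting along the base-changed cover. In degree one,
maps from the kernel extend over `S` because they extend over `R` and the kernel is adapted. In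
higher degrees the group is controlled by Ext of the kernel, filtered by `S ⊗ Δ k` with `k > l`. -/
theorem extZero_baseChange (l m : Λ) (i : ℕ) :
    ExtZero (S ⊗[R] A) (S ⊗[R] Δ l) (S ⊗[R] C m) (i + 1) := by
  obtain ⟨P, _, _, _, _, π, hπ⟩ := hA.exists_cover
  induction l using WellFoundedGT.induction generalizing i with
  | _ l ih =>
    have := hC.projective m
    have := hA.projective l
    have := hA.projective
    have := (hπ.baseChange (S := S) hA.projective).projective l
    have hex := LinearMap.exact_subtype_ker_map (π l)
    have hinj := Submodule.injective_subtype (LinearMap.ker (π l))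
    have hi := baseChangeMap_injective (S := S) (R := R) hinj hex (hπ.surjective l)
    have he := baseChangeMap_exact (S := S) (R := R) hex (hπ.surjective l)
    have hs := baseChangeMap_surjective (S := S) (R := R) (hπ.surjective l)
    have hE : ∀ l, ExtZero A (Δ l) (C m) 1 := fun l => hC.ext_pos l m 1 one_pos
    rcases i with _ | i
    · refine extZero_one_of_extend hi he hs fun φ => exists_extend_baseChange
        ((hπ.filtered l).isAdapted (fun k _ => isAdapted_costandard hA hC k m) fun k _ => hE k)
        (exists_extend_of_extZero hinj hex (hπ.surjective l) (hE l)) φ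
    · refine extZero_succ_of_projective hi he hs ?_
      exact ((hπ.filtered l).baseChange fun k _ => hA.projective k).extZero_left
        (Θ := fun l => S ⊗[R] Δ l) fun k hk => ih k hk i

theorem IsCostandard.baseChange :
    IsCostandard S (S ⊗[R] A) (fun l => S ⊗[R] Δ l) (fun l => S ⊗[R] C l) := by
  have := hA.finite_algebra
  have hfin : ∀ l, Module.Finite R (C l) := fun l =>
    have := hC.finite l
    Module.Finite.trans A _
  have hproj := hC.projective
  refine ⟨fun l => Module.Finite.of_restrictScalars_finite S _ _, fun l => inferInstance,
    hC.dual.dual_baseChange hfin hproj, fun l => ?_, fun l m hlm => ?_, fun l m i hi => ?_⟩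
  · obtain ⟨e⟩ := hC.hom_self l
    have h := homBaseChange_bijective (S := S) (isAdapted_costandard hA hC l l)
    exact ⟨(LinearEquiv.ofBijective _ h).symm ≪≫ₗ e.baseChange R S _ _ ≪≫ₗ
      TensorProduct.AlgebraTensorModule.rid R S S⟩
  · have := hC.hom_of_ne l m hlm
    have h := homBaseChange_bijective (S := S) (isAdapted_costandard hA hC l m)
    exact h.2.subsingleton
  · obtain ⟨i, rfl⟩ := Nat.exists_eq_succ_of_ne_zero hi.ne'
    exact extZero_baseChange hA hC l m i

end Costandard

/-! ### Base change of tilting modules -/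

section Tilting

variable {R S A : Type u} [CommRing R] [CommRing S] [Algebra R S] [Ring A] [Algebra R A]
  {Λ : Type w} [PartialOrder Λ]
  {Δ : Λ → Type u} [∀ l, AddCommGroup (Δ l)] [∀ l, Module R (Δ l)] [∀ l, Module A (Δ l)]
  [∀ l, IsScalarTower R A (Δ l)]
  {C : Λ → Type u} [∀ l, AddCommGroup (C l)] [∀ l, Module R (C l)] [∀ l, Module A (C l)]
  [∀ l, IsScalarTower R A (C l)]

/-- The base change of the cokernel of a map. -/
noncomputable def quotBaseChangeEquiv {M N : Type*} [AddCommGroup M] [Module R M] [Module A M]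
    [IsScalarTower R A M] [AddCommGroup N] [Module R N] [Module A N] [IsScalarTower R A N]
    (f : M →ₗ[A] N) : S ⊗[R] (N ⧸ LinearMap.range f) ≃ₗ[S ⊗[R] A]
      (S ⊗[R] N) ⧸ LinearMap.range (baseChangeMap (R := R) (S := S) f) :=
  let q := baseChangeMap (R := R) (S := S) (LinearMap.range f).mkQ
  have hq : Function.Surjective q :=
    baseChangeMap_surjective (Submodule.mkQ_surjective (LinearMap.range f))
  have hk : LinearMap.range (baseChangeMap (R := R) (S := S) f) = LinearMap.ker q :=
    (LinearMap.exact_iff.mp (baseChangeMap_exact (LinearMap.exact_map_mkQ_range f)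
      (Submodule.mkQ_surjective (LinearMap.range f)))).symm
  ((Submodule.quotEquivOfEq _ _ hk).trans (q.quotKerEquivOfSurjective hq)).symm

theorem IsTiltingFamily.baseChange (hΔ : ∀ l, Module.Projective R (Δ l))
    (hC : ∀ l, Module.Projective R (C l)) {T : Λ → Type u} [∀ l, AddCommGroup (T l)]
    [∀ l, Module R (T l)] [∀ l, Module A (T l)] [∀ l, IsScalarTower R A (T l)]
    (hT : IsTiltingFamily R A Δ C T) :
    IsTiltingFamily S (S ⊗[R] A) (fun l => S ⊗[R] Δ l) (fun l => S ⊗[R] C l)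
      (fun l => S ⊗[R] T l) := by
  refine ⟨fun l => ⟨(hT.partial_tilting l).1.baseChange fun m _ => hΔ m,
    (hT.partial_tilting l).2.baseChange fun m _ => hC m⟩, fun l => ?_, fun l => ?_⟩
  · obtain ⟨i, hi, hF⟩ := hT.standard_seq l
    -- The cokernel `X(l)` is `R`-projective, which keeps `Δ(l) → T(l)` injective after base change.
    have := hF.projective fun m _ => hΔ m
    have hex : Function.Exact i (LinearMap.range i).mkQ := LinearMap.exact_map_mkQ_range i
    have hs := Submodule.mkQ_surjective (LinearMap.range i)
    refine ⟨baseChangeMap i, baseChangeMap_injective hi hex hs,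
      (hF.baseChange fun m _ => hΔ m).congr (quotBaseChangeEquiv i)⟩
  · obtain ⟨p, hp, hF⟩ := hT.costandard_seq l
    have := hC l
    exact ⟨baseChangeMap p, baseChangeMap_surjective hp,
      (hF.baseChange fun m _ => hC m).congr (kerBaseChangeEquiv p hp)⟩

/-- `S ⊗ ⨁ T l = ⨁ S ⊗ T l` as modules over `S ⊗ A`. -/
noncomputable def directSumBaseChangeEquiv {ι : Type w} [DecidableEq ι] (T : ι → Type v)
    [∀ l, AddCommGroup (T l)] [∀ l, Module R (T l)] [∀ l, Module A (T l)]
    [∀ l, IsScalarTower R A (T l)] :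
    S ⊗[R] (⨁ l, T l) ≃ₗ[S ⊗[R] A] ⨁ l, S ⊗[R] T l :=
  { TensorProduct.directSumRight R S S T with
    map_smul' := fun x y => by
      change TensorProduct.directSumRight R S S T (x • y) =
        x • TensorProduct.directSumRight R S S T y
      induction x with
      | zero =>
        have h0 : (0 : S ⊗[R] A) • y = 0 := zero_smul (S ⊗[R] A) y
        rw [h0, map_zero, zero_smul]
      | add x₁ x₂ h₁ h₂ => simp only [add_smul, map_add, h₁, h₂]
      | tmul s a =>
        induction y with
        | zero => simp
        | add y₁ y₂ h₁ h₂ => simp only [smul_add, map_add, h₁, h₂]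
        | tmul t z =>
          induction z using DirectSum.induction_on with
          | zero => simp
          | add z₁ z₂ h₁ h₂ => simp only [TensorProduct.tmul_add, smul_add, map_add, h₁, h₂]
          | of l m =>
            rw [tmul_smul_tmul]
            change TensorProduct.directSumRight R S S T
                ((s * t) ⊗ₜ (a • DirectSum.lof A ι T l m)) =
              (s ⊗ₜ[R] a : S ⊗[R] A) • TensorProduct.directSumRight R S S T
                (t ⊗ₜ DirectSum.lof R ι T l m)
            rw [← map_smul]
            change TensorProduct.directSumRight R S S T
                ((s * t) ⊗ₜ DirectSum.lof R ι T l (a • m)) = _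
            rw [TensorProduct.directSumRight_tmul_lof, TensorProduct.directSumRight_tmul_lof]
            change _ = (s ⊗ₜ[R] a : S ⊗[R] A) • DirectSum.lof (S ⊗[R] A) ι (fun l => S ⊗[R] T l) l
              (t ⊗ₜ m)
            rw [← map_smul, tmul_smul_tmul]
            rfl }

theorem IsCharacteristicTilting.baseChange (hΔ : ∀ l, Module.Projective R (Δ l))
    (hC : ∀ l, Module.Projective R (C l)) {T : Type v} [AddCommGroup T]
    [Module R T] [Module A T] [IsScalarTower R A T] (hT : IsCharacteristicTilting R A Δ C T) :
    IsCharacteristicTilting S (S ⊗[R] A) (fun l => S ⊗[R] Δ l) (fun l => S ⊗[R] C l)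
      (S ⊗[R] T) := by
  classical
  obtain ⟨T', hT', ⟨e⟩⟩ := hT
  let _ : ∀ l, Module R (T' l) := fun l => Module.compHom _ (algebraMap R A)
  have : ∀ l, IsScalarTower R A (T' l) := fun l => .of_algebraMap_smul fun r x => rfl
  have : IsScalarTower R A (⨁ l, T' l) := inferInstance
  exact ⟨fun l => ModuleCat.of (S ⊗[R] A) (S ⊗[R] T' l),
    hT'.baseChange (T := fun l => T' l) hΔ hC,
    ⟨(baseChangeEquiv e).trans (directSumBaseChangeEquiv fun l => T' l)⟩⟩

end Tilting

/-! ### Duality on maps -/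

section DualMap

variable {R A M N : Type*} [CommRing R] [Ring A] [Algebra R A]
  [AddCommGroup M] [Module R M] [Module A M] [IsScalarTower R A M]
  [AddCommGroup N] [Module R N] [Module A N] [IsScalarTower R A N]

variable (R) in
/-- The map `D N → D M` induced by a map `M → N`. -/
def dualMap (h : M →ₗ[A] N) : StdDual R N →ₗ[Aᵐᵒᵖ] StdDual R M where
  toFun φ := φ.toLin ∘ₗ h.restrictScalars R
  map_add' _ _ := rfl
  map_smul' a φ := StdDual.ext R M fun m => by
    change φ.toLin (a.unop • h m) = φ.toLin (h (a.unop • m))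
    rw [h.map_smul]

theorem eq_of_forall_dual [Module.Finite R N] [Module.Projective R N] {x y : N}
    (h : ∀ φ : StdDual R N, φ.toLin x = φ.toLin y) : x = y :=
  (Module.evalEquiv R N).injective (LinearMap.ext h)

theorem dualMap_injective [Module.Finite R N] [Module.Projective R N] {h h' : M →ₗ[A] N}
    (hh : dualMap R h = dualMap R h') : h = h' :=
  LinearMap.ext fun m => eq_of_forall_dual fun φ =>
    congrArg (fun ψ : StdDual R M => ψ.toLin m) (LinearMap.congr_fun hh φ)

/-- Reflexivity of `N` over `R`: the form `φ ↦ ψ(φ)(m)` on `D N` is evaluation at a unique element,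
which is taken as `h m`. -/
theorem exists_dualMap_eq [Module.Finite R N] [Module.Projective R N]
    (ψ : StdDual R N →ₗ[Aᵐᵒᵖ] StdDual R M) : ∃ h : M →ₗ[A] N, dualMap R h = ψ := by
  have hψ : ∀ (r : R) (φ : StdDual R N), ψ (r • φ) = r • ψ φ := fun r φ =>
    (ψ.restrictScalars R).map_smul r φ
  let ev : M → Module.Dual R (Module.Dual R N) := fun m =>
    { toFun := fun φ => (ψ (show StdDual R N from φ)).toLin m
      map_add' := fun φ φ' => by
        change (ψ ((show StdDual R N from φ) + (show StdDual R N from φ'))).toLin m = _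
        rw [map_add]
        rfl
      map_smul' := fun r φ => by
        change (ψ (r • (show StdDual R N from φ))).toLin m = _
        rw [hψ]
        rfl }
  let h : M → N := fun m => (Module.evalEquiv R N).symm (ev m)
  have hh : ∀ (φ : StdDual R N) m, φ.toLin (h m) = (ψ φ).toLin m := fun φ m =>
    LinearMap.congr_fun ((Module.evalEquiv R N).apply_symm_apply (ev m)) φ
  refine ⟨⟨⟨h, fun x y => ?_⟩, fun a x => ?_⟩, LinearMap.ext fun φ => StdDual.ext R M fun m => ?_⟩
  · refine eq_of_forall_dual (R := R) fun φ => ?_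
    rw [map_add, hh, hh, hh, map_add]
  · refine eq_of_forall_dual (R := R) fun φ => ?_
    have h1 : φ.toLin (a • h x) = (MulOpposite.op a • φ).toLin (h x) := rfl
    change φ.toLin (h (a • x)) = φ.toLin (a • h x)
    rw [h1, hh, hh, ψ.map_smul]
    rfl
  · exact hh φ m

/-- If `ker (f' ⊗ W) ≤ ker (f ⊗ W)` for all coefficient modules `W`, then the image of `D f` is
contained in that of `D f'`. -/
theorem mem_range_dualMap {R A M N L : Type u} [CommRing R] [Ring A] [Algebra R A]
    [AddCommGroup M] [Module R M] [Module A M] [IsScalarTower R A M]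
    [AddCommGroup N] [Module R N] [Module A N] [IsScalarTower R A N]
    [AddCommGroup L] [Module R L] [Module A L] [IsScalarTower R A L]
    [Module.Finite R M] [Module.Projective R M] [Module.Finite R L] [Module.Projective R L]
    (f : M →ₗ[A] N) (f' : M →ₗ[A] L)
    (h : ∀ (W : Type u) [AddCommGroup W] [Module R W] (x : M ⊗[R] W),
      (f'.restrictScalars R).rTensor W x = 0 → (f.restrictScalars R).rTensor W x = 0)
    (φ : StdDual R N) : ∃ φ' : StdDual R L, dualMap R f' φ' = dualMap R f φ := by
  obtain ⟨n, x, ξ, -, hξ⟩ := exists_std_dual_basis R M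
  obtain ⟨n', z, ζ, hζ, -⟩ := exists_std_dual_basis R L
  -- The universal test case is `W = D M / I` with `I` the image of `D f'`. The element `∑ xₖ ⊗
  -- [ξₖ]` corresponds to the quotient map `D M → D M / I`. It is killed by `f' ⊗ W`, hence by `f ⊗
  -- W`, and applying `φ` shows that `φ ∘ f` has class zero.
  let I : Submodule R (StdDual R M) := LinearMap.range ((dualMap R f').restrictScalars R)
  have key : ∀ α : StdDual R M, ∑ k, α.toLin (x k) • I.mkQ (ξ k) = I.mkQ α := fun α => by
    conv_rhs => rw [← hξ α, map_sum]
    simp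
  have h0 := h (StdDual R M ⧸ I) (∑ k, x k ⊗ₜ I.mkQ (ξ k)) (by
    have hk : ∀ k, (f'.restrictScalars R).rTensor (StdDual R M ⧸ I) (x k ⊗ₜ I.mkQ (ξ k)) =
        ∑ j, z j ⊗ₜ[R] ((dualMap R f' (ζ j)).toLin (x k) • I.mkQ (ξ k)) := fun k => by
      rw [LinearMap.rTensor_tmul, LinearMap.restrictScalars_apply]
      conv_lhs => rw [← hζ (f' (x k)), TensorProduct.sum_tmul]
      refine Finset.sum_congr rfl fun j _ => ?_
      rw [TensorProduct.smul_tmul]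
      rfl
    rw [map_sum, Finset.sum_congr rfl fun k _ => hk k, Finset.sum_comm]
    refine Finset.sum_eq_zero fun j _ => ?_
    rw [← TensorProduct.tmul_sum, key]
    have : I.mkQ (dualMap R f' (ζ j)) = 0 := by
      rw [Submodule.mkQ_apply, Submodule.Quotient.mk_eq_zero]
      exact ⟨ζ j, rfl⟩
    rw [this, TensorProduct.tmul_zero])
  have h1 := congrArg (fun y => TensorProduct.lid R _ (φ.toLin.rTensor (StdDual R M ⧸ I) y)) h0
  simp only [map_sum, LinearMap.rTensor_tmul, TensorProduct.lid_tmul, map_zero,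
    LinearMap.restrictScalars_apply] at h1
  have h2 : I.mkQ (dualMap R f φ) = 0 := (key (dualMap R f φ)).symm.trans h1
  rw [Submodule.mkQ_apply, Submodule.Quotient.mk_eq_zero] at h2
  exact h2

end DualMap

/-! ### Uniqueness of costandard modules -/

section Uniqueness

variable {R A : Type u} [CommRing R] [Ring A] [Algebra R A]
  {Λ : Type w} [Finite Λ] [PartialOrder Λ]
  {Δ : Λ → Type u} [∀ l, AddCommGroup (Δ l)] [∀ l, Module R (Δ l)] [∀ l, Module A (Δ l)]
  [∀ l, IsScalarTower R A (Δ l)]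
  {P : Λ → Type u} [∀ l, AddCommGroup (P l)] [∀ l, Module R (P l)] [∀ l, Module A (P l)]
  [∀ l, IsScalarTower R A (P l)] {π : ∀ l, P l →ₗ[A] Δ l}
  {C : Λ → Type u} [∀ l, AddCommGroup (C l)] [∀ l, Module R (C l)] [∀ l, Module A (C l)]
  [∀ l, IsScalarTower R A (C l)]
  {C' : Λ → Type u} [∀ l, AddCommGroup (C' l)] [∀ l, Module R (C' l)] [∀ l, Module A (C' l)]
  [∀ l, IsScalarTower R A (C' l)]

theorem IsCostandard.hom_eq_zero (hC : IsCostandard R A Δ C) {l m : Λ} (hlm : l ≠ m)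
    (f : Δ l →ₗ[A] C m) : f = 0 :=
  have := hC.hom_of_ne l m hlm
  Subsingleton.elim _ _

theorem IsCostandard.cover_hom_eq_zero (hC : IsCostandard R A Δ C) (hπ : IsCover R π) {l m : Λ}
    (hlm : ¬ l ≤ m) (f : P l →ₗ[A] C m) : f = 0 :=
  hπ.hom_eq_zero (fun _ hk => hC.hom_eq_zero fun hkm => hlm (hk.trans hkm.le)) f

theorem IsCostandard.exists_generator (hC : IsCostandard R A Δ C) (l : Λ) :
    ∃ f : Δ l →ₗ[A] C l, Function.Bijective fun r : R => r • f := by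
  obtain ⟨e⟩ := hC.hom_self l
  refine ⟨e.symm 1, ?_⟩
  have : (fun r : R => r • e.symm 1) = e.symm := by
    ext1 r
    rw [← map_smul, smul_eq_mul, mul_one]
  rw [this]
  exact e.symm.bijective

theorem IsCostandard.generator_comp_bijective (hC : IsCostandard R A Δ C) (hπ : IsCover R π) {l : Λ}
    {f : Δ l →ₗ[A] C l} (hf : Function.Bijective fun r : R => r • f) :
    Function.Bijective fun r : R => r • (f ∘ₗ π l) := by
  constructor
  · exact fun r s hrs => hf.1 (comp_left_cancel (hπ.surjective l) hrs)
  · intro g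
    obtain ⟨g, rfl⟩ := hπ.exists_comp_eq (fun m hm => hC.hom_eq_zero hm.ne') g
    obtain ⟨r, rfl⟩ := hf.2 g
    exact ⟨r, rfl⟩

/-- There are no nonzero maps `C'(l) → C(m)` between costandard modules unless `m ≤ l`. -/
theorem costandard_hom_eq_zero (hπ : IsCover R π) (hC' : IsCostandard R A Δ C')
    (hC : IsCostandard R A Δ C) {l m : Λ} (hlm : ¬ m ≤ l) (h : C' l →ₗ[A] C m) : h = 0 := by
  refine hπ.generates.eq_zero h fun k a => ?_
  revert a
  refine IsFilteredBy.induction (R := R) (fun M => ∀ a : M →ₗ[A] C' l, h ∘ₗ a = 0) ?_ ?_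
    (hπ.isFilteredBy k)
  · intro M _ _ _ _ _ a
    ext x
    rw [Subsingleton.elim x 0, map_zero, map_zero]
  · intro M' M _ _ _ _ _ _ _ _ U _ _ _ _ f k g _ _ hfg hg ih a
    obtain ⟨c, hc⟩ := exists_desc hfg hg (h ∘ₗ a) (ih (a ∘ₗ f))
    suffices c = 0 by rw [← hc, this, LinearMap.zero_comp]
    have hcu : ∀ v : U, c ∘ₗ (TensorProduct.AlgebraTensorModule.mk R A (Δ k) U).flip v = 0 := by
      intro v
      by_cases hkm : k = m
      · subst hkm
        refine comp_left_cancel (hπ.surjective k) ?_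
        -- By projectivity `P(k) → Δ(k) ⊗ U` lifts to `M`. The composite in question then passes
        -- through a map from `P(k)` to `C' l`, which is zero because `k = m` is not below `l`.
        obtain ⟨p, hp⟩ := hπ.exists_lift hg
          ((TensorProduct.AlgebraTensorModule.mk R A (Δ k) U).flip v ∘ₗ π k)
        rw [LinearMap.comp_assoc, ← hp, ← LinearMap.comp_assoc, hc, LinearMap.comp_assoc,
          hC'.cover_hom_eq_zero hπ hlm (a ∘ₗ p), LinearMap.comp_zero, LinearMap.zero_comp]
      · exact hC.hom_eq_zero hkm _
    refine LinearMap.ext fun z => ?_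
    induction z with
    | zero => rw [map_zero, map_zero]
    | add x y hx hy => rw [map_add, map_add, hx, hy]
    | tmul d v => exact LinearMap.congr_fun (hcu v) d

/-- A submodule of `C(l) ⊗ W` receiving no nonzero map from `P(l)` is zero. -/
theorem IsCostandard.subsingleton_of_hom_cover (hA : IsSplitQuasiHereditary R A Δ)
    (hπ : IsCover R π) (hC : IsCostandard R A Δ C) {l : Λ} {W : Type u} [AddCommGroup W]
    [Module R W] (Z : Submodule A (C l ⊗[R] W)) (hZ : ∀ b : P l →ₗ[A] Z, b = 0) : Z = ⊥ := by
  have hall : ∀ (k : Λ) (b : P k →ₗ[A] Z), b = 0 := by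
    intro k
    induction k using WellFoundedGT.induction with
    | _ k ih =>
      intro b
      by_cases hkl : k = l
      · subst hkl
        exact hZ b
      · obtain ⟨b, rfl⟩ := hπ.exists_comp_eq (fun m hm => hπ.standard_hom_eq_zero (ih m hm)) b
        have hb : Z.subtype ∘ₗ b = 0 := by
          have := hC.hom_of_ne k l hkl
          obtain ⟨x, hx⟩ := ((isAdapted_costandard hA hC k l).bijective W).2 (Z.subtype ∘ₗ b)
          rw [← hx, Subsingleton.elim x 0, map_zero]
        have : b = 0 := LinearMap.ext fun x => Subtype.ext (LinearMap.congr_fun hb x)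
        rw [this, LinearMap.zero_comp]
  have h0 : Z.subtype = 0 := hπ.generates.eq_zero _ fun k b => by
    rw [hall k b, LinearMap.comp_zero]
  rw [← Z.range_subtype, h0, LinearMap.range_zero]

/-- It suffices that the image under `f ⊗ W` of the kernel of `f' ⊗ W` receives no nonzero map from
`P l`. Such a map lifts to the kernel, where it has the form `y ↦ π y ⊗ w`. Then `(f' ∘ π) ⊗ w = 0`,
and `w = 0` because `f' ∘ π` is a free generator of `Hom(P l, C' l)`. -/
theorem rTensor_eq_zero_of_generators (hA : IsSplitQuasiHereditary R A Δ)
    (hπ : IsCover R π) (hC' : IsCostandard R A Δ C') (hC : IsCostandard R A Δ C) {l : Λ}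
    {f' : Δ l →ₗ[A] C' l} (hf' : Function.Bijective fun r : R => r • f')
    (f : Δ l →ₗ[A] C l) {W : Type u} [AddCommGroup W] [Module R W] (x : Δ l ⊗[R] W)
    (hx : (f'.restrictScalars R).rTensor W x = 0) : (f.restrictScalars R).rTensor W x = 0 := by
  let F' : Δ l ⊗[R] W →ₗ[A] C' l ⊗[R] W := TensorProduct.AlgebraTensorModule.map f' LinearMap.id
  let F : Δ l ⊗[R] W →ₗ[A] C l ⊗[R] W := TensorProduct.AlgebraTensorModule.map f LinearMap.id
  have hZ : (LinearMap.ker F').map F = ⊥ := by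
    refine hC.subsingleton_of_hom_cover hA hπ _ fun b => ?_
    obtain ⟨c, rfl⟩ := hπ.exists_lift (F.submoduleMap_surjective (LinearMap.ker F')) b
    suffices c = 0 by rw [this, LinearMap.comp_zero]
    have hΔ := hA.projective l
    obtain ⟨w, hw⟩ := (hπ.tensor_bijective (W := W) hA l).2 ((LinearMap.ker F').subtype ∘ₗ c)
    have := hC'.projective l
    have h0 : homTensor R A (P l) (C' l) W ((f' ∘ₗ π l) ⊗ₜ w) = 0 := by
      have : F' ∘ₗ (LinearMap.ker F').subtype ∘ₗ c = 0 := LinearMap.ext fun y => (c y).2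
      rw [← hw] at this
      exact this
    have h1 := (injective_iff_map_eq_zero _).mp ((hπ.isAdapted l (C' l)).bijective W).1 _ h0
    have h2 : w = 0 := (tmul_bijective_of_generator (W := W)
      (hC'.generator_comp_bijective hπ hf')).1 (h1.trans (TensorProduct.tmul_zero _ _).symm)
    rw [h2] at hw
    simp only [TensorProduct.tmul_zero, map_zero] at hw
    exact LinearMap.ext fun y => Subtype.ext (LinearMap.congr_fun hw y).symm
  have hmem : F x ∈ (LinearMap.ker F').map F := ⟨x, hx, rfl⟩
  rw [hZ] at hmem
  exact hmem

/-- A cover `ρ` of `D C(l)` over `Aᵒᵖ`, followed by `D f`, lands in the image of `D f'` and so lifts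
to `D C'(l)`. The lift kills the kernel of `ρ`, which is filtered by `D C(m)` with `m > l`: a map `D
C(m) → D C'(l)` is dual to a map `C'(l) → C(m)`, hence zero. The induced map `D C(l) → D C'(l)` is
the dual of `g`. -/
theorem exists_comp_generator (hA : IsSplitQuasiHereditary R A Δ)
    (hC' : IsCostandard R A Δ C') (hC : IsCostandard R A Δ C) {l : Λ}
    {f' : Δ l →ₗ[A] C' l} (hf' : Function.Bijective fun r : R => r • f')
    (f : Δ l →ₗ[A] C l) : ∃ g : C' l →ₗ[A] C l, g ∘ₗ f' = f := by
  obtain ⟨P, _, _, _, _, π, hπ⟩ := hA.exists_cover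
  obtain ⟨Q, _, _, _, _, ρ, hρ⟩ := hC.dual.exists_cover
  have := hA.finite_algebra
  have := hA.projective l
  have := hC'.projective
  have := hC.projective
  have : Module.Finite R (Δ l) := have := hA.finite l; Module.Finite.trans A _
  have : ∀ m, Module.Finite R (C' m) := fun m => have := hC'.finite m; Module.Finite.trans A _
  have : ∀ m, Module.Finite R (C m) := fun m => have := hC.finite m; Module.Finite.trans A _
  have hrange := mem_range_dualMap f f' fun W _ _ x hx =>
    rTensor_eq_zero_of_generators hA hπ hC' hC hf' f x hx
  obtain ⟨a, ha⟩ := hρ.exists_lift (dualMap R f').surjective_rangeRestrict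
    (LinearMap.codRestrict (LinearMap.range (dualMap R f')) (dualMap R f ∘ₗ ρ l)
      fun q => hrange (ρ l q))
  obtain ⟨b, rfl⟩ := hρ.exists_comp_eq (fun m hm ψ => by
    obtain ⟨h, rfl⟩ := exists_dualMap_eq ψ
    rw [costandard_hom_eq_zero hπ hC' hC hm.not_ge h]
    exact LinearMap.ext fun φ => StdDual.ext R _ fun m => map_zero φ.toLin) a
  obtain ⟨g, rfl⟩ := exists_dualMap_eq b
  refine ⟨g, dualMap_injective (R := R) (comp_left_cancel (hρ.surjective l) ?_)⟩
  exact LinearMap.ext fun q => congrArg Subtype.val (LinearMap.congr_fun ha q)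

/-- The endomorphisms of `D C(l)` are the scalars in `R`, so by reflexivity `h` is a scalar `r`.
From `r f = f` and freeness of `f` follows `r = 1`. -/
theorem IsCostandard.eq_id_of_comp_generator (hA : Module.Finite R A) (hC : IsCostandard R A Δ C)
    {l : Λ} {f : Δ l →ₗ[A] C l} (hf : Function.Bijective fun r : R => r • f)
    (h : C l →ₗ[A] C l) (hh : h ∘ₗ f = f) : h = LinearMap.id := by
  have := hC.projective l
  have : Module.Finite R (C l) := have := hC.finite l; Module.Finite.trans A _
  obtain ⟨r, hr⟩ := (hC.dual.algebraMap_end_bijective l).2 (dualMap R h)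
  have hr' : ∀ y, h y = r • y := fun y => eq_of_forall_dual (R := R) fun φ => by
    have := congrArg (fun ψ : StdDual R (C l) => ψ.toLin y) (LinearMap.congr_fun hr φ)
    rw [map_smul]
    exact this.symm
  have h1 : r = 1 := by
    refine hf.1 ?_
    ext x
    dsimp only
    rw [one_smul, LinearMap.smul_apply, ← hr', ← LinearMap.comp_apply, hh]
  ext y
  rw [hr', h1, one_smul, LinearMap.id_apply]

/-- Costandard modules are unique up to isomorphism. -/
theorem IsCostandard.nonempty_equiv (hA : IsSplitQuasiHereditary R A Δ)
    (hC' : IsCostandard R A Δ C') (hC : IsCostandard R A Δ C) (l : Λ) :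
    Nonempty (C' l ≃ₗ[A] C l) := by
  obtain ⟨f', hf'⟩ := hC'.exists_generator l
  obtain ⟨f, hf⟩ := hC.exists_generator l
  obtain ⟨g, hg⟩ := exists_comp_generator hA hC' hC hf' f
  obtain ⟨g', hg'⟩ := exists_comp_generator hA hC hC' hf f'
  exact ⟨LinearEquiv.ofLinearMap g g'
    (hC.eq_id_of_comp_generator hA.finite_algebra hf _ (by rw [LinearMap.comp_assoc, hg', hg]))
    (hC'.eq_id_of_comp_generator hA.finite_algebra hf' _ (by rw [LinearMap.comp_assoc, hg, hg']))⟩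

end Uniqueness

end SplitQH

/-! ### The base change theorem -/

open SplitQH in
theorem mainTheorem11
    {R A S : Type u} [CommRing R] [IsNoetherianRing R] [Ring A] [Algebra R A]
    [CommRing S] [IsNoetherianRing S] [Algebra R S]
    {Λ : Type w} [Finite Λ] [PartialOrder Λ]
    (Δ : Λ → Type u) [∀ l, AddCommGroup (Δ l)] [∀ l, Module R (Δ l)]
    [∀ l, Module A (Δ l)] [∀ l, IsScalarTower R A (Δ l)]
    (C : Λ → Type u) [∀ l, AddCommGroup (C l)] [∀ l, Module R (C l)]
    [∀ l, Module A (C l)] [∀ l, IsScalarTower R A (C l)]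
    (hA : IsSplitQuasiHereditary R A Δ) (hC : IsCostandard R A Δ C) :
    IsSplitQuasiHereditary S (S ⊗[R] A) (fun l => S ⊗[R] Δ l) ∧
    IsCostandard S (S ⊗[R] A) (fun l => S ⊗[R] Δ l) (fun l => S ⊗[R] C l) ∧
    (∀ (C' : Λ → Type u) [∀ l, AddCommGroup (C' l)] [∀ l, Module S (C' l)]
      [∀ l, Module (S ⊗[R] A) (C' l)] [∀ l, IsScalarTower S (S ⊗[R] A) (C' l)],
      IsCostandard S (S ⊗[R] A) (fun l => S ⊗[R] Δ l) C' →
        ∀ l, Nonempty (C' l ≃ₗ[S ⊗[R] A] S ⊗[R] C l)) ∧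
    (∀ (T : Λ → Type u) [∀ l, AddCommGroup (T l)] [∀ l, Module R (T l)]
      [∀ l, Module A (T l)] [∀ l, IsScalarTower R A (T l)],
      IsTiltingFamily R A Δ C T →
        IsTiltingFamily S (S ⊗[R] A) (fun l => S ⊗[R] Δ l) (fun l => S ⊗[R] C l)
          (fun l => S ⊗[R] T l)) ∧
    (∀ (T : Type v) [AddCommGroup T] [Module R T] [Module A T] [IsScalarTower R A T],
      IsCharacteristicTilting R A Δ C T →
        IsCharacteristicTilting S (S ⊗[R] A) (fun l => S ⊗[R] Δ l) (fun l => S ⊗[R] C l)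
          (S ⊗[R] T)) ∧
    (∀ (M N : Type u) [AddCommGroup M] [Module R M] [Module A M] [IsScalarTower R A M]
      [AddCommGroup N] [Module R N] [Module A N] [IsScalarTower R A N],
      IsFilteredBy R A Δ Set.univ M → IsFilteredBy R A C Set.univ N →
        Function.Bijective (homBaseChange R S A M N)) := by
  have hΔ := hA.projective
  have hC' := hC.projective
  refine ⟨hA.baseChange, hC.baseChange hA, ?_, ?_, ?_, ?_⟩
  · intro C' _ _ _ _ h l
    exact h.nonempty_equiv hA.baseChange (hC.baseChange hA) l
  · intro T _ _ _ _ hT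
    exact hT.baseChange hΔ hC'
  · intro T _ _ _ _ hT
    exact hT.baseChange hΔ hC'
  · intro M N _ _ _ _ _ _ _ _ hM hN
    exact homBaseChange_bijective (isAdapted_of_filtered hA hC hM hN)
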